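/- Let $S\subset\mathbb R^3$ be a smooth strictly convex surface, i.e. the smooth boundary of a convex body (compact, with interior points) whose Gauss curvature $K$ is everywhere positive, oriented by a continuous unit normal field $\nu$ (either one). Let $p\in S$, fix a unit vector $e\in T_pS$, and for $\psi\in\mathbb R$ let $\Gamma_\psi$ be the unit speed geodesic with $\Gamma_\psi(0)=p$ and $\Gamma_\psi'(0)=\cos\psi\,e+\sin\psi\,(\nu(p)\times e)$. Put $X(s,\psi)=\Gamma_\psi(s)$, $T=\partial X/\partial s$ and $N=\nu(X)\times T$. Let $\xi(\cdot,\psi)$ be the solution of $\xi_{,ss}+K(X(s,\psi))\,\xi=0$ with $\xi(0,\psi)=0$, $\xi_{,s}(0,\psi)=1$, let $R(\psi)$ be its first positive zero, and let $\beta(\psi)=X(R(\psi),\psi)$ be the conjugate locus of $p$. All these objects are well defined for all $s,\psi\in\mathbb R$, $\partial X/\partial\psi=\xi N$, the function $R$ is differentiable, and $\beta'(\psi)=R'(\psi)\,T(R(\psi),\psi)$. Where $R'(\psi)\neq0$, orient $\beta$ by the tangent $\tau(\psi)=T(R(\psi),\psi)$ of the radial geodesic, so that its arc length $\sigma$ in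 this orientation satisfies $d\sigma=R'(\psi)\,d\psi$, and let $k_g$ be its geodesic curvature, defined by $\frac{D\tau}{d\sigma}=k_g\,(\nu\times\tau)$, where $D$ is the covariant derivative of $S$. Then: 1. $\xi_{,s}(R(\psi),\psi)<0$ for every $\psi$; 2. for every $\psi$ with $R'(\psi)\neq0$, the field $\tau$ is differentiable at $\psi$, $$k_g(\psi)=\frac{\xi_{,s}(R(\psi),\psi)}{R'(\psi)},$$ and in particular $k_g(\psi)\neq0$; 3. if $a<b$ and $R'\neq0$ on $(a,b)$ (an arc of the conjugate locus; its end points may be cusps), then $k_g\,\frac{d\sigma}{d\psi}$ and $\xi_{,s}(R(\psi),\psi)$ are integrable on $[a,b]$ and the total curvature of the arc is $$\int k_g\,d\sigma=\int_a^b k_g\,\frac{d\sigma}{d\psi}\,d\psi=\int_a^b\xi_{,s}(R(\psi),\psi)\,d\psi .$$ -/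

import Mathlib

open scoped ContDiff RealInnerProductSpace

noncomputable section

namespace ConjLocus

/-- Euclidean three-space. -/
abbrev E3 : Type := EuclideanSpace ℝ (Fin 3)

/-- The cross product on Euclidean three-space. -/
def cross (a b : E3) : E3 := WithLp.toLp 2 (crossProduct a.ofLp b.ofLp)

/-- `S` is a smooth embedded surface: near each of its points it is a regular level set. -/
def IsSmoothSurface (S : Set E3) : Prop :=
  ∀ q ∈ S, ∃ U : Set E3, IsOpen U ∧ q ∈ U ∧ ∃ F : E3 → ℝ,
    ContDiffOn ℝ ∞ F U ∧ (∀ x ∈ U, fderiv ℝ F x ≠ 0) ∧ S ∩ U = {x ∈ U | F x = 0}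

/-- `ν` restricts to a continuous unit normal field on `S`, that is, to an orientation of `S`
(the values of `ν` off `S` are irrelevant). -/
structure IsUnitNormalField (S : Set E3) (ν : E3 → E3) : Prop where
  continuousOn : ContinuousOn ν S
  norm_eq_one : ∀ q ∈ S, ‖ν q‖ = 1
  inner_eq_zero : ∀ q ∈ S, ∀ v ∈ tangentConeAt ℝ S q, ⟪ν q, v⟫ = 0

/-- The tangent plane of `S` at `q`: the plane orthogonal to the unit normal. -/
abbrev tangentPlane (ν : E3 → E3) (q : E3) : Submodule ℝ E3 := (ℝ ∙ ν q)ᗮ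

/-- The differential of the Gauss map, as an endomorphism of the tangent plane. (The derivative
of `ν` within `S` is determined by `ν` and `S` on tangent vectors, and has tangent values.) -/
def gaussMapDeriv (S : Set E3) (ν : E3 → E3) (q : E3) :
    tangentPlane ν q →ₗ[ℝ] tangentPlane ν q :=
  (((tangentPlane ν q).orthogonalProjectionOnto.comp (fderivWithin ℝ ν S q)).comp
    (tangentPlane ν q).subtypeL).toLinearMap

/-- The Gauss curvature: the determinant of the differential of the Gauss map. -/
def gaussCurvature (S : Set E3) (ν : E3 → E3) (q : E3) : ℝ :=
  LinearMap.det (gaussMapDeriv S ν q)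

/-- `S`, oriented by the unit normal field `ν`, is a smooth strictly convex surface: the smooth
boundary of a convex body, with everywhere positive Gauss curvature. -/
structure IsSmoothStrictlyConvexSurface (S : Set E3) (ν : E3 → E3) : Prop where
  exists_body : ∃ C : Set E3, Convex ℝ C ∧ IsCompact C ∧ (interior C).Nonempty ∧ S = frontier C
  smooth : IsSmoothSurface S
  normal : IsUnitNormalField S ν
  curvature_pos : ∀ q ∈ S, 0 < gaussCurvature S ν q

/-- The covariant derivative `DV/dt` of a vector field `V` along a curve `c` in the surface:
the tangential part of the ordinary derivative. -/
def covDeriv (ν : E3 → E3) (c V : ℝ → E3) (t : ℝ) : E3 :=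
  deriv V t - ⟪deriv V t, ν (c t)⟫ • ν (c t)

/-- A geodesic of `S`, defined for all time. -/
structure IsGeodesic (S : Set E3) (ν : E3 → E3) (γ : ℝ → E3) : Prop where
  contDiff : ContDiff ℝ 2 γ
  mem : ∀ t, γ t ∈ S
  covDeriv_eq_zero : ∀ t, covDeriv ν γ (deriv γ) t = 0

/-- The geodesic with initial point `p` and initial velocity `v`. -/
def geodesic (S : Set E3) (ν : E3 → E3) (p v : E3) : ℝ → E3 :=
  Classical.epsilon fun γ => IsGeodesic S ν γ ∧ γ 0 = p ∧ deriv γ 0 = v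

/-- The unit tangent vector at `p` that makes the angle `ψ` with the fixed unit tangent vector
`e`, angles being measured in the orientation of the tangent plane given by `ν p`. -/
def direction (ν : E3 → E3) (p e : E3) (ψ : ℝ) : E3 :=
  Real.cos ψ • e + Real.sin ψ • cross (ν p) e

/-- The exponential map in polar coordinates, `X(s, ψ) = Γ_ψ(s)`. -/
def polarExp (S : Set E3) (ν : E3 → E3) (p e : E3) (s ψ : ℝ) : E3 :=
  geodesic S ν p (direction ν p e ψ) s

/-- The unit tangent `T(s, ψ) = ∂X/∂s` of the radial geodesic `Γ_ψ`. -/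
def radialTangent (S : Set E3) (ν : E3 → E3) (p e : E3) (s ψ : ℝ) : E3 :=
  deriv (fun t => polarExp S ν p e t ψ) s

/-- The unit normal `N(s, ψ)` in the surface of the radial geodesic `Γ_ψ`, such that
`(T, N)` is positively oriented. -/
def radialNormal (S : Set E3) (ν : E3 → E3) (p e : E3) (s ψ : ℝ) : E3 :=
  cross (ν (polarExp S ν p e s ψ)) (radialTangent S ν p e s ψ)

/-- `y` solves the scalar Jacobi equation `y'' + k y = 0` with `y(0) = 0`, `y'(0) = 1`. -/
structure IsScalarJacobi (k y : ℝ → ℝ) : Prop where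
  contDiff : ContDiff ℝ 2 y
  zero : y 0 = 0
  deriv_zero : deriv y 0 = 1
  equation : ∀ s, deriv (deriv y) s + k s * y s = 0

/-- The scalar Jacobi field `ξ(s, ψ)` along the radial geodesic `Γ_ψ`. -/
def xi (S : Set E3) (ν : E3 → E3) (p e : E3) (s ψ : ℝ) : ℝ :=
  Classical.epsilon
    (fun y => IsScalarJacobi (fun t => gaussCurvature S ν (polarExp S ν p e t ψ)) y) s

/-- The partial derivative `ξ_{,s}(s, ψ)`. -/
def xiDeriv (S : Set E3) (ν : E3 → E3) (p e : E3) (s ψ : ℝ) : ℝ :=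
  deriv (fun t => xi S ν p e t ψ) s

/-- The distance function `R(ψ)`: the first positive zero of `ξ(·, ψ)`. -/
def distFun (S : Set E3) (ν : E3 → E3) (p e : E3) (ψ : ℝ) : ℝ :=
  sInf {s : ℝ | 0 < s ∧ xi S ν p e s ψ = 0}

/-- The conjugate locus of `p`, parametrised by `β(ψ) = X(R(ψ), ψ)`. -/
def conjLocus (S : Set E3) (ν : E3 → E3) (p e : E3) (ψ : ℝ) : E3 :=
  polarExp S ν p e (distFun S ν p e ψ) ψ

/-- The vector field `ψ ↦ T(R(ψ), ψ)` along the conjugate locus. -/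
def conjTangent (S : Set E3) (ν : E3 → E3) (p e : E3) (ψ : ℝ) : E3 :=
  radialTangent S ν p e (distFun S ν p e ψ) ψ

/-- The speed `dσ/dt` of a curve `c` with respect to the arc length `σ` that increases in the
direction of the unit tangent field `τ` along `c`. -/
def signedSpeed (c τ : ℝ → E3) (t : ℝ) : ℝ := ⟪deriv c t, τ t⟫

/-- The geodesic curvature of a curve `c` in the surface oriented by `ν`, where `c` is oriented by
the unit tangent field `τ` along it: the number `k` in the Frenet equation
`Dτ/dσ = k n`, in which `n = ν × τ` and `Dτ/dσ = (dσ/dt)⁻¹ Dτ/dt`. It is meaningful where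
`dσ/dt ≠ 0`. -/
def geodesicCurvature (ν : E3 → E3) (c τ : ℝ → E3) (t : ℝ) : ℝ :=
  ⟪(signedSpeed c τ t)⁻¹ • covDeriv ν c τ t, cross (ν (c t)) (τ t)⟫

end ConjLocus

end

/-! The theorem rests on the variation of the radial geodesics. The field `ξ N` along `Γ_ψ` solves
the linearised geodesic equation with the initial value of the variation in `ψ`, so `∂X/∂ψ = ξ N`,
and the velocity component of the same solution is `∂T/∂ψ = ξ_s N - ξ II(N, T) ν`. At `s = R(ψ)` the
factor `ξ` vanishes, which leaves `∂X/∂ψ = 0` and `∂T/∂ψ = ξ_s N`. The chain rule gives `β' = R' τ`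
and `τ' = R' ∂T/∂s + ξ_s N`. Since `∂T/∂s` is normal to the surface, the covariant derivative of `τ`
is `ξ_s N`; division by the signed speed `R'` gives the curvature. Multiplying back, `k_g dσ/dψ`
equals `ξ_s(R(ψ), ψ)` between cusps, and that function is continuous across cusps, hence the
integral formula. The sign of `ξ_s` holds because `ξ` is positive before its first zero and has no
double zeros.

Most of the work is the regularity behind this computation. The Gauss map extends to a smooth map
`G` of the space (`exists_contDiff_extension`), so geodesics are integral curves of a smooth field
on `E3 × E3` that stay in the compact unit tangent bundle (`exists_geodesic`). Compactness gives
global existence, positive lower and finite upper curvature bounds, and bounds uniform in `ψ`.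
Differentiability in `ψ` is a Gronwall estimate (`hasDerivAt_param_of_bounded`), and
`IsGeodesic.hasDerivAt_jacobiField` identifies the derivative as `ξ N`. Sturm comparison makes `R`
finite; `continuous_firstZero` and `differentiableAt_of_implicit` make it differentiable. -/

noncomputable section
namespace ConjLocus

open Set Filter Topology Metric NNReal

/-! ### Global existence for ordinary differential equations. -/

section ODE

variable {E : Type*} [NormedAddCommGroup E] [NormedSpace ℝ E]

/-- Solutions on all bounded intervals glue to a global solution. -/
theorem exists_global_solution_of_forall_Ioo {f : ℝ → E → E} {x₀ : E}
    (hv : ∀ T : ℝ, ∃ K : ℝ≥0, ∀ t ∈ Ioo (-T) T, LipschitzWith K (f t))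
    (hex : ∀ T : ℝ, 0 < T → ∃ α : ℝ → E, α 0 = x₀ ∧
      ∀ t ∈ Ioo (-T) T, HasDerivAt α (f t (α t)) t) :
    ∃ u : ℝ → E, u 0 = x₀ ∧ ∀ t, HasDerivAt u (f t (u t)) t := by
  choose! α hα0 hα using hex
  have key : ∀ S T : ℝ, 0 < S → S ≤ T → EqOn (α S) (α T) (Ioo (-S) S) := by
    intro S T hS hST
    obtain ⟨K, hK⟩ := hv S
    refine ODE_solution_unique_of_mem_Ioo (v := f) (s := fun _ => univ) (K := K) (t₀ := 0)
      (fun t ht => (hK t ht).lipschitzOnWith) ⟨by linarith, hS⟩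
      (fun t ht => ⟨hα S hS t ht, trivial⟩)
      (fun t ht => ⟨hα T (hS.trans_le hST) t ⟨by linarith [ht.1], by linarith [ht.2]⟩, trivial⟩) ?_
    rw [hα0 S hS, hα0 T (hS.trans_le hST)]
  -- The interval of half-length `|t| + 1` varies with `t`; near a fixed `t` all these solutions
  -- agree with the single one on half-length `|t| + 2`.
  refine ⟨fun t => α (|t| + 1) t, by simpa using hα0 1 one_pos, fun t => ?_⟩
  have hT : (0 : ℝ) < |t| + 2 := by positivity
  have hev : (fun t => α (|t| + 1) t) =ᶠ[𝓝 t] α (|t| + 2) := by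
    have : ∀ᶠ r in 𝓝 t, |r| < |t| + 1 := by
      have : Tendsto (fun r : ℝ => |r|) (𝓝 t) (𝓝 |t|) := continuous_abs.tendsto t
      exact this.eventually_lt_const (by linarith)
    filter_upwards [this] with r hr
    refine key _ _ (by positivity) (by linarith) ?_
    rw [mem_Ioo, ← abs_lt]; linarith
  have h := hα (|t| + 2) hT t (by rw [mem_Ioo, ← abs_lt]; linarith)
  have e : α (|t| + 1) t = α (|t| + 2) t := hev.self_of_nhds
  simp only [e]
  exact h.congr_of_eventuallyEq hev

/-- A bounded Lipschitz time-dependent vector field has solutions on every bounded interval. -/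
theorem exists_solution_Ioo_of_bounded [CompleteSpace E] {f : ℝ → E → E} (x₀ : E) {T : ℝ}
    (hT : 0 < T) {K L : ℝ≥0} (hK : ∀ t ∈ Icc (-T) T, LipschitzWith K (f t))
    (hL : ∀ t ∈ Icc (-T) T, ∀ x, ‖f t x‖ ≤ L)
    (hf : ∀ x, Continuous fun t => f t x) :
    ∃ α : ℝ → E, α 0 = x₀ ∧ ∀ t ∈ Ioo (-T) T, HasDerivAt α (f t (α t)) t := by
  have h0 : (0 : ℝ) ∈ Icc (-T) T := ⟨by linarith, hT.le⟩
  -- At speed at most `L` no solution leaves the ball of radius `L * T` within time `T`, so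
  -- Picard-Lindelöf covers the whole interval.
  have hpl : IsPicardLindelof f ⟨0, h0⟩ x₀ (L * ⟨T, hT.le⟩) 0 L K :=
    { lipschitzOnWith := fun t ht => (hK t ht).lipschitzOnWith
      continuousOn := fun x _ => (hf x).continuousOn
      norm_le := fun t ht x _ => hL t ht x
      mul_max_le := by
        simp only [sub_zero, sub_neg_eq_add, zero_add, max_self, NNReal.coe_zero]
        exact le_rfl }
  obtain ⟨α, h1, h2⟩ := hpl.exists_eq_forall_mem_Icc_hasDerivWithinAt₀
  exact ⟨α, h1, fun t ht => (h2 t (Ioo_subset_Icc_self ht)).hasDerivAt (Icc_mem_nhds ht.1 ht.2)⟩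

/-- A `C¹` compactly supported vector field is complete. -/
theorem exists_global_solution_of_hasCompactSupport [CompleteSpace E] {f : E → E}
    (hf : ContDiff ℝ 1 f) (hc : HasCompactSupport f) (x₀ : E) :
    ∃ u : ℝ → E, u 0 = x₀ ∧ ∀ t, HasDerivAt u (f (u t)) t := by
  obtain ⟨K, hK⟩ := ContDiff.lipschitzWith_of_hasCompactSupport hc hf one_ne_zero
  obtain ⟨L, hL⟩ := hc.exists_bound_of_continuous hf.continuous
  refine exists_global_solution_of_forall_Ioo (f := fun _ => f) (fun T => ⟨K, fun _ _ => hK⟩)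
    fun T hT => exists_solution_Ioo_of_bounded (f := fun _ => f) x₀ hT (K := K)
      (L := ⟨max L 0, le_max_right _ _⟩) (fun _ _ => hK) (fun _ _ x => (hL x).trans (le_max_left _ _))
      fun _ => continuous_const

/-- Gronwall's inequality on both sides of `0`; negative times follow by reversing time. -/
theorem norm_le_mul_exp_of_norm_deriv_le {w w' : ℝ → E} {T : ℝ} {L : ℝ} (hL : 0 ≤ L)
    (hw : ∀ t ∈ Ioo (-T) T, HasDerivAt w (w' t) t)
    (hb : ∀ t ∈ Ioo (-T) T, ‖w' t‖ ≤ L * ‖w t‖) :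
    ∀ t ∈ Ioo (-T) T, ‖w t‖ ≤ ‖w 0‖ * Real.exp (L * T) := by
  have fwd : ∀ {w w' : ℝ → E}, (∀ t ∈ Ioo (-T) T, HasDerivAt w (w' t) t) →
      (∀ t ∈ Ioo (-T) T, ‖w' t‖ ≤ L * ‖w t‖) → ∀ t ∈ Ico 0 T,
      ‖w t‖ ≤ ‖w 0‖ * Real.exp (L * T) := by
    intro w w' hw hb t ht
    have hsub : ∀ r ∈ Icc 0 t, r ∈ Ioo (-T) T := fun r hr =>
      ⟨by linarith [hr.1, ht.1, ht.2], by linarith [hr.2, ht.2]⟩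
    have := norm_le_gronwallBound_of_norm_deriv_right_le (f := w) (f' := w') (δ := ‖w 0‖) (K := L)
      (ε := 0) (a := 0) (b := t)
      (fun r hr => (hw r (hsub r hr)).continuousAt.continuousWithinAt)
      (fun r hr => (hw r (hsub r (Ico_subset_Icc_self hr))).hasDerivWithinAt) le_rfl
      (fun r hr => by simpa using hb r (hsub r (Ico_subset_Icc_self hr))) t ⟨ht.1, le_rfl⟩
    rw [gronwallBound_ε0, sub_zero] at this
    refine this.trans ?_
    gcongr
    exact ht.2.le
  intro t ht
  rcases le_total 0 t with h | h
  · exact fwd hw hb t ⟨h, ht.2⟩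
  · have hneg : ∀ r ∈ Ioo (-T) T, -r ∈ Ioo (-T) T := fun r hr =>
      ⟨by linarith [hr.2], by linarith [hr.1]⟩
    have := fwd (w := fun r => w (-r)) (w' := fun r => -w' (-r))
      (fun r hr => by
        have := (hw (-r) (hneg r hr)).scomp r (hasDerivAt_neg r)
        simpa [Function.comp_def] using this)
      (fun r hr => by simpa using hb (-r) (hneg r hr)) (-t) ⟨by linarith, by linarith [ht.1]⟩
    simpa using this

/-- Linear differential equations have global solutions. -/
theorem exists_global_solution_linear [FiniteDimensional ℝ E] {A : ℝ → E →L[ℝ] E}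
    (hA : Continuous A) (x₀ : E) :
    ∃ u : ℝ → E, u 0 = x₀ ∧ ∀ t, HasDerivAt u (A t (u t)) t := by
  have : CompleteSpace E := FiniteDimensional.complete ℝ E
  have hbd : ∀ T : ℝ, ∃ L : ℝ≥0, ∀ t ∈ Icc (-T) T, ‖A t‖ ≤ L := by
    intro T
    obtain ⟨C, hC⟩ := (isCompact_Icc (a := -T) (b := T)).exists_bound_of_continuousOn hA.continuousOn
    exact ⟨⟨max C 0, le_max_right _ _⟩, fun t ht => (hC t ht).trans (le_max_left _ _)⟩
  refine exists_global_solution_of_forall_Ioo (f := fun t x => A t x) (fun T => ?_) fun T hT => ?_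
  · obtain ⟨L, hL⟩ := hbd T
    exact ⟨L, fun t ht => (A t).lipschitz.weaken (hL t (Ioo_subset_Icc_self ht))⟩
  obtain ⟨L, hL⟩ := hbd T
  -- `M` exceeds the a priori Gronwall bound. The truncation `θ` does not increase norms, so the
  -- truncated equation obeys the same bound, and its solution stays where `θ` is the identity.
  set M : ℝ := ‖x₀‖ * Real.exp (L * T) + 1 with hM
  have hM0 : 0 < M := by positivity
  let b : ContDiffBump (0 : E) := ⟨M, M + 1, hM0, by linarith⟩
  let θ : E → E := fun x => b x • x
  have hθ : ContDiff ℝ 1 θ := b.contDiff.smul contDiff_id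
  have hθc : HasCompactSupport θ := b.hasCompactSupport.smul_right
  have hθn : ∀ x, ‖θ x‖ ≤ ‖x‖ := fun x => by
    rw [norm_smul, Real.norm_of_nonneg b.nonneg]
    exact mul_le_of_le_one_left (norm_nonneg _) b.le_one
  obtain ⟨Kθ, hKθ⟩ := ContDiff.lipschitzWith_of_hasCompactSupport hθc hθ one_ne_zero
  obtain ⟨B, hB⟩ := hθc.exists_bound_of_continuous hθ.continuous
  have hB0 : 0 ≤ B := (norm_nonneg _).trans (hB 0)
  obtain ⟨α, h0, hα⟩ := exists_solution_Ioo_of_bounded (f := fun t x => A t (θ x)) x₀ hT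
    (K := L * Kθ) (L := L * ⟨B, hB0⟩)
    (fun t ht => ((A t).lipschitz.weaken (hL t ht)).comp hKθ)
    (fun t ht x => ((A t).le_opNorm _).trans (mul_le_mul (hL t ht) (hB x) (norm_nonneg _) L.2))
    (fun x => hA.clm_apply continuous_const)
  refine ⟨α, h0, fun t ht => ?_⟩
  have hbound := norm_le_mul_exp_of_norm_deriv_le L.2 hα (fun r hr =>
    ((A r).le_opNorm _).trans (mul_le_mul (hL r (Ioo_subset_Icc_self hr)) (hθn _)
      (norm_nonneg _) L.2)) t ht
  have : θ (α t) = α t := by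
    have : b (α t) = 1 := b.one_of_mem_closedBall (by
      rw [mem_closedBall_zero_iff]
      change _ ≤ M
      rw [h0] at hbound
      exact hbound.trans (by rw [hM]; exact (lt_add_one _).le))
    simp [θ, this]
  have h := hα t ht
  simp only [this] at h
  exact h

end ODE

/-! ### Continuity and differentiability of solutions in a parameter. -/

section Dependence

variable {E : Type*} [NormedAddCommGroup E] [NormedSpace ℝ E]

/-- Lets a common factor `ε * ‖ψ - ψ₀‖` of the initial error and of the forcing be pulled out of the
Gronwall estimate. -/
theorem gronwallBound_mul (c δ K ε x : ℝ) :
    gronwallBound (c * δ) K (c * ε) x = c * gronwallBound δ K ε x := by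
  unfold gronwallBound
  split_ifs <;> ring

/-- Uniform first-order Taylor estimate for a `C¹` map on a ball. -/
theorem exists_forall_norm_sub_sub_fderiv_le [FiniteDimensional ℝ E] {f : E → E}
    (hf : ContDiff ℝ 1 f) (r : ℝ) {ε : ℝ} (hε : 0 < ε) :
    ∃ δ > 0, ∀ x ∈ closedBall (0 : E) r, ∀ y ∈ closedBall (0 : E) r, ‖y - x‖ < δ →
      ‖f y - f x - fderiv ℝ f x (y - x)‖ ≤ ε * ‖y - x‖ := by
  have : ProperSpace E := FiniteDimensional.proper ℝ E
  have hu := (isCompact_closedBall (0 : E) r).uniformContinuousOn_of_continuous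
    (hf.continuous_fderiv one_ne_zero).continuousOn
  rw [Metric.uniformContinuousOn_iff] at hu
  obtain ⟨δ, hδ, h⟩ := hu ε hε
  refine ⟨δ, hδ, fun x hx y hy hxy => ?_⟩
  have hconv : Convex ℝ (closedBall (0 : E) r ∩ ball x δ) :=
    (convex_closedBall _ _).inter (convex_ball _ _)
  refine hconv.norm_image_sub_le_of_norm_fderiv_le' (𝕜 := ℝ) (f := f)
    (fun z _ => (hf.differentiable one_ne_zero) z) (fun z hz => ?_) ⟨hx, mem_ball_self hδ⟩
    ⟨hy, by rwa [mem_ball, dist_eq_norm]⟩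
  have := h z hz.1 x hx hz.2
  rw [dist_eq_norm] at this
  exact this.le

variable {f : E → E} {u : ℝ → ℝ → E}

/-- Solutions that stay in a bounded set depend on the initial value in a Lipschitz way. -/
theorem exists_forall_norm_sub_le_of_bounded [FiniteDimensional ℝ E] (hf : ContDiff ℝ 1 f)
    {M : ℝ} (hu : ∀ s ∈ Icc 0 M, ∀ ψ, HasDerivAt (fun t => u t ψ) (f (u s ψ)) s)
    (hb : ∃ r, ∀ s ∈ Icc 0 M, ∀ ψ, ‖u s ψ‖ ≤ r) :
    ∃ C, 0 ≤ C ∧ ∀ s ∈ Icc 0 M, ∀ ψ φ, ‖u s ψ - u s φ‖ ≤ C * ‖u 0 ψ - u 0 φ‖ := by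
  have : ProperSpace E := FiniteDimensional.proper ℝ E
  obtain ⟨r, hr⟩ := hb
  obtain ⟨K, hK⟩ := hf.contDiffOn.exists_lipschitzOnWith (n := 1) (s := closedBall (0 : E) r)
    one_ne_zero (convex_closedBall _ _) (isCompact_closedBall _ _)
  refine ⟨Real.exp (K * M), by positivity, fun s hs ψ φ => ?_⟩
  have := dist_le_of_trajectories_ODE_of_mem (v := fun _ => f) (K := K)
    (s := fun _ => closedBall (0 : E) r) (a := 0) (b := M) (f := fun t => u t ψ)
    (g := fun t => u t φ) (δ := dist (u 0 ψ) (u 0 φ)) (fun _ _ => hK)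
    (fun t ht => (hu t ht ψ).continuousAt.continuousWithinAt)
    (fun t ht => (hu t (Ico_subset_Icc_self ht) ψ).hasDerivWithinAt)
    (fun t ht => by simpa using hr t (Ico_subset_Icc_self ht) ψ)
    (fun t ht => (hu t ht φ).continuousAt.continuousWithinAt)
    (fun t ht => (hu t (Ico_subset_Icc_self ht) φ).hasDerivWithinAt)
    (fun t ht => by simpa using hr t (Ico_subset_Icc_self ht) φ) le_rfl s hs
  rw [sub_zero, dist_eq_norm, dist_eq_norm, mul_comm] at this
  refine this.trans ?_
  gcongr
  exact hs.2

/-- The remainder `u s ψ - u s ψ₀ - (ψ - ψ₀) • w s` solves the linearised equation up to a Taylor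
error, which is at most `ε` times a multiple of `‖ψ - ψ₀‖` by Lipschitz dependence on the initial
value. Gronwall then makes the remainder `o(ψ - ψ₀)`. -/
theorem hasDerivAt_param_of_bounded_forward [FiniteDimensional ℝ E] (hf : ContDiff ℝ 1 f)
    {M : ℝ} (hu : ∀ s ∈ Icc 0 M, ∀ ψ, HasDerivAt (fun t => u t ψ) (f (u s ψ)) s)
    (hb : ∃ r, ∀ s ∈ Icc 0 M, ∀ ψ, ‖u s ψ‖ ≤ r) {ψ₀ : ℝ} {w : ℝ → E}
    (hw : ∀ s ∈ Icc 0 M, HasDerivAt w (fderiv ℝ f (u s ψ₀) (w s)) s)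
    (h0 : HasDerivAt (fun ψ => u 0 ψ) (w 0) ψ₀) :
    ∀ s ∈ Icc 0 M, HasDerivAt (fun ψ => u s ψ) (w s) ψ₀ := by
  have : ProperSpace E := FiniteDimensional.proper ℝ E
  obtain ⟨C, hC0, hC⟩ := exists_forall_norm_sub_le_of_bounded hf hu hb
  obtain ⟨r, hr⟩ := hb
  obtain ⟨K, hK⟩ := (isCompact_closedBall (0 : E) r).exists_bound_of_continuousOn
    (hf.continuous_fderiv one_ne_zero).continuousOn
  intro s hs
  set K' := max K 0
  have hK0 : 0 ≤ K' := le_max_right _ _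
  have hKK : ∀ t ∈ Icc 0 M, ‖fderiv ℝ f (u t ψ₀)‖ ≤ K' := fun t ht =>
    (hK _ (by simpa using hr t ht ψ₀)).trans (le_max_left _ _)
  set D := ‖w 0‖ + 1
  have hD : 0 < D := by positivity
  set G := gronwallBound 1 K' (C * D) s
  have hG : 0 ≤ G := by
    have := gronwallBound_mono zero_le_one (mul_nonneg hC0 hD.le) hK0 hs.1
    rw [gronwallBound_x0] at this
    exact zero_le_one.trans this
  rw [hasDerivAt_iff_isLittleO, Asymptotics.isLittleO_iff]
  intro c hc
  obtain ⟨ε, hε, hεG⟩ : ∃ ε > 0, ε * G ≤ c := by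
    refine ⟨c / (G + 1), by positivity, ?_⟩
    rw [div_mul_eq_mul_div, div_le_iff₀ (by positivity)]
    nlinarith
  obtain ⟨δ, hδ, hT⟩ := exists_forall_norm_sub_sub_fderiv_le hf r hε
  have h1 : ∀ᶠ ψ in 𝓝 ψ₀, ‖u 0 ψ - u 0 ψ₀ - (ψ - ψ₀) • w 0‖ ≤ min ε 1 * ‖ψ - ψ₀‖ := by
    rw [hasDerivAt_iff_isLittleO, Asymptotics.isLittleO_iff] at h0
    exact h0 (by positivity)
  have h2 : ∀ᶠ ψ in 𝓝 ψ₀, C * (D * ‖ψ - ψ₀‖) < δ := by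
    have : Tendsto (fun ψ : ℝ => C * (D * ‖ψ - ψ₀‖)) (𝓝 ψ₀) (𝓝 (C * (D * ‖ψ₀ - ψ₀‖))) :=
      Continuous.tendsto (by fun_prop) _
    refine this.eventually_lt_const (by simpa using hδ)
  filter_upwards [h1, h2] with ψ hψ1 hψ2
  have hu0 : ‖u 0 ψ - u 0 ψ₀‖ ≤ D * ‖ψ - ψ₀‖ := by
    have e : u 0 ψ - u 0 ψ₀ = (u 0 ψ - u 0 ψ₀ - (ψ - ψ₀) • w 0) + (ψ - ψ₀) • w 0 := by abel
    rw [e]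
    refine (norm_add_le _ _).trans ?_
    rw [norm_smul]
    have : min ε 1 * ‖ψ - ψ₀‖ ≤ 1 * ‖ψ - ψ₀‖ := by gcongr; exact min_le_right _ _
    calc _ ≤ 1 * ‖ψ - ψ₀‖ + ‖ψ - ψ₀‖ * ‖w 0‖ := by gcongr; exact hψ1.trans this
      _ = _ := by simp only [D]; ring
  have hut : ∀ t ∈ Icc 0 M, ‖u t ψ - u t ψ₀‖ ≤ C * (D * ‖ψ - ψ₀‖) := fun t ht =>
    (hC t ht ψ ψ₀).trans (by gcongr)
  have hz : ∀ t ∈ Icc 0 M, HasDerivAt (fun t => u t ψ - u t ψ₀ - (ψ - ψ₀) • w t)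
      (f (u t ψ) - f (u t ψ₀) - (ψ - ψ₀) • fderiv ℝ f (u t ψ₀) (w t)) t := fun t ht =>
    ((hu t ht ψ).sub (hu t ht ψ₀)).sub ((hw t ht).const_smul _)
  have hsub : Icc 0 s ⊆ Icc 0 M := Icc_subset_Icc_right hs.2
  have := norm_le_gronwallBound_of_norm_deriv_right_le
    (f := fun t => u t ψ - u t ψ₀ - (ψ - ψ₀) • w t)
    (f' := fun t => f (u t ψ) - f (u t ψ₀) - (ψ - ψ₀) • fderiv ℝ f (u t ψ₀) (w t))
    (δ := ε * ‖ψ - ψ₀‖ * 1) (K := K') (ε := ε * ‖ψ - ψ₀‖ * (C * D)) (a := 0) (b := s)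
    (fun t ht => (hz t (hsub ht)).continuousAt.continuousWithinAt)
    (fun t ht => (hz t (hsub (Ico_subset_Icc_self ht))).hasDerivWithinAt)
    (hψ1.trans (by rw [mul_one]; gcongr; exact min_le_left _ _))
    (fun t ht => by
      have htM := hsub (Ico_subset_Icc_self ht)
      have e : f (u t ψ) - f (u t ψ₀) - (ψ - ψ₀) • fderiv ℝ f (u t ψ₀) (w t) =
          fderiv ℝ f (u t ψ₀) (u t ψ - u t ψ₀ - (ψ - ψ₀) • w t) +
          (f (u t ψ) - f (u t ψ₀) - fderiv ℝ f (u t ψ₀) (u t ψ - u t ψ₀)) := by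
        simp only [map_sub, map_smul]; abel
      rw [e]
      refine (norm_add_le _ _).trans (add_le_add ?_ ?_)
      · exact ((fderiv ℝ f (u t ψ₀)).le_opNorm _).trans (by gcongr; exact hKK t htM)
      · refine (hT _ (by simpa using hr t htM ψ₀) _ (by simpa using hr t htM ψ)
          ((hut t htM).trans_lt hψ2)).trans ?_
        calc ε * ‖u t ψ - u t ψ₀‖ ≤ ε * (C * (D * ‖ψ - ψ₀‖)) := by gcongr; exact hut t htM
          _ = _ := by ring) s ⟨hs.1, le_rfl⟩
  rw [gronwallBound_mul, sub_zero] at this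
  refine this.trans ?_
  calc ε * ‖ψ - ψ₀‖ * G = ε * G * ‖ψ - ψ₀‖ := by ring
    _ ≤ _ := by gcongr


/-- Differentiability of solutions in a parameter: the derivative is the solution of the
linearised equation. -/
theorem hasDerivAt_param_of_bounded [FiniteDimensional ℝ E] (hf : ContDiff ℝ 1 f)
    (hu : ∀ s ψ, HasDerivAt (fun t => u t ψ) (f (u s ψ)) s)
    (hb : ∀ M, ∃ r, ∀ s ∈ Icc (-M) M, ∀ ψ, ‖u s ψ‖ ≤ r) {ψ₀ : ℝ} {w : ℝ → E}
    (hw : ∀ s, HasDerivAt w (fderiv ℝ f (u s ψ₀) (w s)) s)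
    (h0 : HasDerivAt (fun ψ => u 0 ψ) (w 0) ψ₀) (s : ℝ) :
    HasDerivAt (fun ψ => u s ψ) (w s) ψ₀ := by
  rcases le_total 0 s with h | h
  · refine hasDerivAt_param_of_bounded_forward (M := s) hf (fun t _ => hu t) ?_ (fun t _ => hw t) h0
      s ⟨h, le_rfl⟩
    obtain ⟨r, hr⟩ := hb s
    exact ⟨r, fun t ht => hr t ⟨by linarith [ht.1], ht.2⟩⟩
  · have := hasDerivAt_param_of_bounded_forward (M := -s) (f := fun x => -f x)
      (u := fun t ψ => u (-t) ψ) (w := fun t => w (-t)) (ψ₀ := ψ₀) hf.neg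
      (fun t _ ψ => by
        have := (hu (-t) ψ).scomp t (hasDerivAt_neg t)
        simpa [Function.comp_def] using this) ?_ (fun t _ => by
        have := (hw (-t)).scomp t (hasDerivAt_neg t)
        rw [fderiv_fun_neg]
        simpa [Function.comp_def] using this) (by simpa using h0)
      (-s) ⟨by linarith, le_rfl⟩
    · simpa using this
    obtain ⟨r, hr⟩ := hb (-s)
    exact ⟨r, fun t ht => hr (-t) ⟨by linarith [ht.2], by linarith [ht.1]⟩⟩

/-- Bounded solutions with continuous initial values are jointly continuous. -/
theorem continuous_uncurry_of_bounded [FiniteDimensional ℝ E] (hf : ContDiff ℝ 1 f)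
    (hu : ∀ s ψ, HasDerivAt (fun t => u t ψ) (f (u s ψ)) s)
    (hb : ∀ M, ∃ r, ∀ s ∈ Icc (-M) M, ∀ ψ, ‖u s ψ‖ ≤ r)
    (h0 : Continuous fun ψ => u 0 ψ) : Continuous fun q : ℝ × ℝ => u q.1 q.2 := by
  have hlip : ∀ M, ∃ C, 0 ≤ C ∧ ∀ s ∈ Icc (-M) M, ∀ ψ φ, ‖u s ψ - u s φ‖ ≤ C * ‖u 0 ψ - u 0 φ‖ := by
    intro M
    obtain ⟨r, hr⟩ := hb M
    obtain ⟨C₁, hC₁, h₁⟩ := exists_forall_norm_sub_le_of_bounded (M := M) hf (fun t _ => hu t)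
      ⟨r, fun t ht => hr t ⟨by linarith [ht.1, ht.2], ht.2⟩⟩
    obtain ⟨C₂, hC₂, h₂⟩ := exists_forall_norm_sub_le_of_bounded (M := M) (f := fun x => -f x)
      (u := fun t ψ => u (-t) ψ) hf.neg
      (fun t _ ψ => by
        have := (hu (-t) ψ).scomp t (hasDerivAt_neg t)
        simpa [Function.comp_def] using this)
      ⟨r, fun t ht => hr (-t) ⟨by linarith [ht.2], by linarith [ht.1, ht.2]⟩⟩
    refine ⟨max C₁ C₂, hC₁.trans (le_max_left _ _), fun s hs ψ φ => ?_⟩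
    rcases le_total 0 s with h | h
    · exact (h₁ s ⟨h, hs.2⟩ ψ φ).trans (by gcongr; exact le_max_left _ _)
    · have := h₂ (-s) ⟨by linarith, by linarith [hs.1]⟩ ψ φ
      simp only [neg_neg, neg_zero] at this
      exact this.trans (by gcongr; exact le_max_right _ _)
  rw [continuous_iff_continuousAt]
  rintro ⟨s, ψ⟩
  obtain ⟨C, hC0, hC⟩ := hlip (|s| + 1)
  rw [ContinuousAt, tendsto_iff_norm_sub_tendsto_zero]
  have hnear : ∀ᶠ q : ℝ × ℝ in 𝓝 (s, ψ), q.1 ∈ Icc (-(|s| + 1)) (|s| + 1) := by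
    have : ∀ᶠ q : ℝ × ℝ in 𝓝 (s, ψ), |q.1| < |s| + 1 :=
      ((continuous_abs.comp continuous_fst).tendsto (s, ψ)).eventually_lt_const (by simp)
    exact this.mono fun q hq => abs_le.1 hq.le
  refine squeeze_zero' (Eventually.of_forall fun _ => norm_nonneg _)
    (g := fun q => C * ‖u 0 q.2 - u 0 ψ‖ + ‖u q.1 ψ - u s ψ‖) ?_ ?_
  · filter_upwards [hnear] with q hq
    calc ‖u q.1 q.2 - u s ψ‖ = ‖(u q.1 q.2 - u q.1 ψ) + (u q.1 ψ - u s ψ)‖ := by congr 1; abel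
      _ ≤ _ := (norm_add_le _ _).trans (by gcongr; exact hC _ hq _ _)
  · have hc : Continuous fun s => u s ψ :=
      continuous_iff_continuousAt.2 fun s => (hu s ψ).continuousAt
    have : Continuous fun q : ℝ × ℝ => C * ‖u 0 q.2 - u 0 ψ‖ + ‖u q.1 ψ - u s ψ‖ := by fun_prop
    have := this.tendsto (s, ψ)
    simpa using this

end Dependence

/-! ### Curves in regular level sets. -/

section LevelSet

variable {E : Type*} [NormedAddCommGroup E] [InnerProductSpace ℝ E]

theorem mem_tangentConeAt_of_hasDerivAt {S : Set E} {γ : ℝ → E} {v : E} {t : ℝ}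
    (h : HasDerivAt γ v t) (hS : ∀ᶠ r in 𝓝 t, γ r ∈ S) : v ∈ tangentConeAt ℝ S (γ t) := by
  have hs := hasDerivAt_iff_tendsto_slope_zero.1 h
  have hadd : Tendsto (fun r : ℝ => t + r) (𝓝[≠] 0) (𝓝 t) := by
    have : Tendsto (fun r : ℝ => t + r) (𝓝 0) (𝓝 (t + 0)) := Continuous.tendsto (by fun_prop) _
    rw [add_zero] at this
    exact this.mono_left nhdsWithin_le_nhds
  refine mem_tangentConeAt_of_seq (𝓝[≠] (0 : ℝ)) (fun r => r⁻¹) (fun r => γ (t + r) - γ t) ?_ ?_ hs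
  · have := (h.continuousAt.tendsto.comp hadd).sub_const (γ t)
    simpa [Function.comp_def] using this
  · filter_upwards [hadd.eventually hS] with r hr
    simpa using hr

theorem inner_gradient_eq [CompleteSpace E] (F : E → ℝ) (x v : E) :
    ⟪gradient F x, v⟫ = fderiv ℝ F x v := by
  simp [gradient]

theorem ContDiffOn.gradient [CompleteSpace E] {F : E → ℝ} {U : Set E} (hU : IsOpen U)
    (hF : ContDiffOn ℝ ∞ F U) : ContDiffOn ℝ ∞ (gradient F) U :=
  (InnerProductSpace.toDual ℝ E).symm.toContinuousLinearEquiv.contDiff.comp_contDiffOn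
    (hF.fderiv_of_isOpen hU (by simp))

/-- Through every point of a regular level set and in every direction tangent to it there is a
curve in the level set whose acceleration is normal to it. -/
theorem exists_curve_in_levelSet [CompleteSpace E] {F : E → ℝ} {U : Set E} (hU : IsOpen U)
    (hF : ContDiffOn ℝ ∞ F U) (hF' : ∀ x ∈ U, fderiv ℝ F x ≠ 0) {x v : E} (hx : x ∈ U)
    (hFx : F x = 0) (hv : fderiv ℝ F x v = 0) :
    ∃ γ γ' : ℝ → E, γ 0 = x ∧ γ' 0 = v ∧ ∀ᶠ t in 𝓝 0, γ t ∈ U ∧ F (γ t) = 0 ∧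
      HasDerivAt γ (γ' t) t ∧ ∃ c : ℝ, HasDerivAt γ' (c • gradient F (γ t)) t := by
  have hg := ContDiffOn.gradient hU hF
  have hg0 : ∀ y ∈ U, gradient F y ≠ 0 := fun y hy h => hF' y hy (by
    simpa [gradient] using h)
  have hD1 : ContDiffOn ℝ ∞ (fderiv ℝ F) U := hF.fderiv_of_isOpen hU (by simp)
  have hD2 : ContDiffOn ℝ ∞ (fderiv ℝ (fderiv ℝ F)) U := hD1.fderiv_of_isOpen hU (by simp)
  -- The multiple of the gradient is chosen so that `F` has zero second derivative along solutions;
  -- `F` and its first derivative vanish initially, so the curve stays in the level set.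
  let f : E × E → E × E := fun z =>
    (z.2, (-(fderiv ℝ (fderiv ℝ F) z.1 z.2 z.2 / ⟪gradient F z.1, gradient F z.1⟫)) •
      gradient F z.1)
  have hf : ContDiffAt ℝ 1 f (x, v) := by
    have hUx : U ∈ 𝓝 x := hU.mem_nhds hx
    have h1 : ContDiffAt ℝ 1 (fun z : E × E => gradient F z.1) (x, v) :=
      ContDiffAt.comp (g := gradient F) (x, v) ((hg.contDiffAt hUx).of_le (by simp)) contDiffAt_fst
    have h2 : ContDiffAt ℝ 1 (fun z : E × E => fderiv ℝ (fderiv ℝ F) z.1) (x, v) :=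
      ContDiffAt.comp (g := fderiv ℝ (fderiv ℝ F)) (x, v)
        ((hD2.contDiffAt hUx).of_le (by simp)) contDiffAt_fst
    refine contDiffAt_snd.prodMk (ContDiffAt.smul (ContDiffAt.neg (ContDiffAt.div ?_ ?_ ?_)) h1)
    · exact (h2.clm_apply contDiffAt_snd).clm_apply contDiffAt_snd
    · exact h1.inner ℝ h1
    · exact fun h => hg0 x hx (inner_self_eq_zero.1 h)
  obtain ⟨α, hα0, ε, hε, hα⟩ := 
    ContDiffAt.exists_forall_mem_closedBall_exists_eq_forall_mem_Ioo_hasDerivAt₀ hf 0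
  have hc : ContinuousAt α 0 := (hα 0 (by simp [hε])).continuousAt
  have hUev : ∀ᶠ t in 𝓝 (0 : ℝ), (α t).1 ∈ U :=
    (continuous_fst.continuousAt.comp hc).eventually_mem (by
      simp only [Function.comp, hα0]; exact hU.mem_nhds hx)
  obtain ⟨δ, hδ, hδU⟩ := Metric.eventually_nhds_iff_ball.1
    (hUev.and (Ioo_mem_nhds (show (0 : ℝ) - ε < 0 by linarith) (show (0 : ℝ) < 0 + ε by linarith)))
  have h1 : ∀ t ∈ ball (0 : ℝ) δ, HasDerivAt (fun t => (α t).1) (α t).2 t := fun t ht =>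
    (hα t (hδU t ht).2).fst
  have h2 : ∀ t ∈ ball (0 : ℝ) δ, HasDerivAt (fun t => (α t).2) (f (α t)).2 t := fun t ht =>
    (hα t (hδU t ht).2).snd
  have hconst : ∀ a : ℝ → ℝ, (∀ t ∈ ball (0 : ℝ) δ, HasDerivAt a 0 t) → a 0 = 0 →
      ∀ t ∈ ball (0 : ℝ) δ, a t = 0 := by
    intro a ha ha0 t ht
    have := (convex_ball (0 : ℝ) δ).norm_image_sub_le_of_norm_hasDerivWithin_le (f := a)
      (f' := fun _ => 0) (C := 0) (fun r hr => (ha r hr).hasDerivWithinAt) (by simp)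
      (mem_ball_self hδ) ht
    simpa [ha0] using this
  have hb : ∀ t ∈ ball (0 : ℝ) δ, fderiv ℝ F (α t).1 (α t).2 = 0 := by
    refine hconst _ (fun t ht => ?_) (by simp [hα0, hv])
    have hUt := hU.mem_nhds (hδU t ht).1
    have hd : HasFDerivAt (fderiv ℝ F) (fderiv ℝ (fderiv ℝ F) (α t).1) (α t).1 :=
      ((hD1.contDiffAt hUt).differentiableAt (by simp)).hasFDerivAt
    have hA : HasDerivAt (fun t => fderiv ℝ F (α t).1)
        (fderiv ℝ (fderiv ℝ F) (α t).1 (α t).2) t := hd.comp_hasDerivAt t (h1 t ht)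
    have hne : ⟪gradient F (α t).1, gradient F (α t).1⟫ ≠ 0 :=
      fun h => hg0 _ (hδU t ht).1 (inner_self_eq_zero.1 h)
    have hzero : fderiv ℝ (fderiv ℝ F) (α t).1 (α t).2 (α t).2 +
        fderiv ℝ F (α t).1 (f (α t)).2 = 0 := by
      rw [show (f (α t)).2 = (-(fderiv ℝ (fderiv ℝ F) (α t).1 (α t).2 (α t).2 /
        ⟪gradient F (α t).1, gradient F (α t).1⟫)) • gradient F (α t).1 from rfl, map_smul,
        ← inner_gradient_eq F (α t).1 (gradient F (α t).1), smul_eq_mul, neg_mul,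
        div_mul_cancel₀ _ hne, add_neg_cancel]
    have := hA.clm_apply (h2 t ht)
    rwa [hzero] at this
  have ha : ∀ t ∈ ball (0 : ℝ) δ, F (α t).1 = 0 := by
    refine hconst _ (fun t ht => ?_) (by simp [hα0, hFx])
    have hUt := hU.mem_nhds (hδU t ht).1
    have hd : HasFDerivAt F (fderiv ℝ F (α t).1) (α t).1 :=
      ((hF.contDiffAt hUt).differentiableAt (by simp)).hasFDerivAt
    have := hd.comp_hasDerivAt t (h1 t ht)
    rwa [hb t ht] at this
  refine ⟨fun t => (α t).1, fun t => (α t).2, by simp [hα0], by simp [hα0], ?_⟩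
  filter_upwards [ball_mem_nhds (0 : ℝ) hδ] with t ht
  exact ⟨(hδU t ht).1, ha t ht, h1 t ht, _, h2 t ht⟩

end LevelSet

/-! ### The unit normal field, local geodesics and the smooth extension of the Gauss map. -/

section Normal

variable {S : Set E3} {ν : E3 → E3}

/-- A smooth surface with unit normal `ν` is locally a regular level set of a function whose
gradient is a multiple of `ν`. -/
theorem exists_local_equation (hS : IsSmoothSurface S) (hν : IsUnitNormalField S ν)
    {q : E3} (hq : q ∈ S) :
    ∃ U : Set E3, IsOpen U ∧ q ∈ U ∧ ∃ F : E3 → ℝ, ContDiffOn ℝ ∞ F U ∧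
      (∀ x ∈ U, fderiv ℝ F x ≠ 0) ∧ S ∩ U = {x ∈ U | F x = 0} ∧
      ∀ x ∈ S, x ∈ U → fderiv ℝ F x (ν x) ≠ 0 ∧
        gradient F x = fderiv ℝ F x (ν x) • ν x := by
  obtain ⟨U, hU, hqU, F, hF, hF', hSU⟩ := hS q hq
  refine ⟨U, hU, hqU, F, hF, hF', hSU, fun x hx hxU => ?_⟩
  have hFx : F x = 0 := by
    have : x ∈ S ∩ U := ⟨hx, hxU⟩
    rw [hSU] at this
    exact this.2
  -- Each kernel vector of `dF` is the velocity of a curve in `S`, hence orthogonal to `ν x`; so `ν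
  -- x` has no component orthogonal to the gradient.
  have hker : ∀ v, fderiv ℝ F x v = 0 → ⟪ν x, v⟫ = 0 := by
    intro v hv
    obtain ⟨γ, γ', h0, h0', hγ⟩ := exists_curve_in_levelSet hU hF hF' hxU hFx hv
    have h := hγ.self_of_nhds.2.2.1
    have := mem_tangentConeAt_of_hasDerivAt (S := S) h (hγ.mono fun t ht => by
      have : γ t ∈ S ∩ U := by rw [hSU]; exact ⟨ht.1, ht.2.1⟩
      exact this.1)
    rw [h0, h0'] at this
    exact hν.inner_eq_zero x hx v this
  set g := gradient F x with hg
  have hg0 : ⟪g, g⟫ ≠ 0 := fun h => hF' x hxU (by simpa [hg, gradient] using h)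
  set c := ⟪g, ν x⟫ / ⟪g, g⟫ with hc
  have hgu : ⟪g, ν x - c • g⟫ = 0 := by
    rw [inner_sub_right, inner_smul_right, hc]; field_simp; simp
  have hνu : ⟪ν x, ν x - c • g⟫ = 0 := hker _ (by rw [← inner_gradient_eq]; exact hgu)
  have hu : ν x - c • g = 0 := by
    rw [← inner_self_eq_zero (𝕜 := ℝ)]
    conv_lhs => rw [inner_sub_left, inner_smul_left]
    rw [hνu, hgu]; simp
  have hνc : ν x = c • g := sub_eq_zero.1 hu
  have hν1 := hν.norm_eq_one x hx
  have hc0 : c ≠ 0 := by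
    rintro h
    rw [hνc, h] at hν1
    simp at hν1
  have hgc : g = c⁻¹ • ν x := by rw [hνc, smul_smul, inv_mul_cancel₀ hc0, one_smul]
  have : fderiv ℝ F x (ν x) = c⁻¹ := by
    rw [← inner_gradient_eq, ← hg, hgc, inner_smul_left, real_inner_self_eq_norm_sq, hν1]
    simp
  rw [this]
  exact ⟨inv_ne_zero hc0, hgc⟩

/-- Through every point of the surface and in every tangent direction there is a local geodesic. -/
theorem exists_local_geodesic (hS : IsSmoothSurface S) (hν : IsUnitNormalField S ν)
    {x v : E3} (hx : x ∈ S) (hv : ⟪ν x, v⟫ = 0) :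
    ∃ γ γ' : ℝ → E3, γ 0 = x ∧ γ' 0 = v ∧ ∀ᶠ t in 𝓝 0, γ t ∈ S ∧
      HasDerivAt γ (γ' t) t ∧ ∃ c : ℝ, HasDerivAt γ' (c • ν (γ t)) t := by
  obtain ⟨U, hU, hxU, F, hF, hF', hSU, hg⟩ := exists_local_equation hS hν hx
  have hFx : F x = 0 := by
    have : x ∈ S ∩ U := ⟨hx, hxU⟩
    rw [hSU] at this
    exact this.2
  obtain ⟨γ, γ', h0, h0', hγ⟩ := exists_curve_in_levelSet hU hF hF' hxU hFx (v := v) (by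
    rw [← inner_gradient_eq, (hg x hx hxU).2, inner_smul_left, hv, mul_zero])
  refine ⟨γ, γ', h0, h0', hγ.mono fun t ht => ?_⟩
  have hS : γ t ∈ S := by
    have : γ t ∈ S ∩ U := by rw [hSU]; exact ⟨ht.1, ht.2.1⟩
    exact this.1
  obtain ⟨c, hc⟩ := ht.2.2.2
  rw [(hg _ hS ht.1).2, smul_smul] at hc
  exact ⟨hS, ht.2.2.1, _, hc⟩

/-- The local geodesic with velocity `v` witnesses membership. Thus the tangent cone contains the
whole plane orthogonal to `ν x`, and derivatives within `S` are determined there. -/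
theorem mem_tangentConeAt_of_inner_eq_zero (hS : IsSmoothSurface S) (hν : IsUnitNormalField S ν)
    {x v : E3} (hx : x ∈ S) (hv : ⟪ν x, v⟫ = 0) : v ∈ tangentConeAt ℝ S x := by
  obtain ⟨γ, γ', h0, h0', hγ⟩ := exists_local_geodesic hS hν hx hv
  have := mem_tangentConeAt_of_hasDerivAt hγ.self_of_nhds.2.1 (hγ.mono fun t ht => ht.1)
  rwa [h0, h0'] at this

theorem inner_normal_deriv_eq_zero (hν : IsUnitNormalField S ν) {γ : ℝ → E3} {v : E3} {t : ℝ}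
    (hγ : ∀ᶠ r in 𝓝 t, γ r ∈ S) (h : HasDerivAt γ v t) : ⟪ν (γ t), v⟫ = 0 :=
  hν.inner_eq_zero _ hγ.self_of_nhds _ (mem_tangentConeAt_of_hasDerivAt h hγ)

/-- The unit normal field of a closed smooth surface extends to a smooth map of the space. -/
theorem exists_contDiff_extension (hS : IsSmoothSurface S) (hν : IsUnitNormalField S ν)
    (hc : IsClosed S) : ∃ G : E3 → E3, ContDiff ℝ ∞ G ∧ EqOn G ν S := by
  classical
  -- A partition of unity glues local extensions: on `S` the value is constrained to a singleton,
  -- off `S` it is free, and both constraints are convex.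
  have key := exists_contMDiffMap_forall_mem_convex_of_local (I := modelWithCornersSelf ℝ E3)
    (M := E3) (F := E3) (n := ⊤) (t := fun x => if x ∈ S then {ν x} else univ)
    (fun x => by split_ifs; exacts [convex_singleton _, convex_univ]) ?_
  · obtain ⟨G, hG⟩ := key
    refine ⟨G, G.contMDiff.contDiff, fun x hx => ?_⟩
    have := hG x
    simpa [hx] using this
  intro q
  by_cases hq : q ∈ S
  swap
  · refine ⟨Sᶜ, hc.isOpen_compl.mem_nhds hq, fun _ => 0, contMDiffOn_const, fun y hy => ?_⟩
    simp [show y ∉ S from hy]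
  obtain ⟨U, hU, hqU, F, hF, hF', hSU, hg⟩ := exists_local_equation hS hν hq
  -- On `S` the normal is the normalised gradient times the sign of `σ`. Continuity of `ν` keeps
  -- this sign constant near `q`, so the sign at `q` gives a smooth local extension.
  let σ : E3 → ℝ := fun x => fderiv ℝ F x (ν x)
  have hσ : ContinuousWithinAt σ S q := by
    have h1 : ContinuousAt (fderiv ℝ F) q :=
      ((hF.fderiv_of_isOpen hU (m := ∞) (by simp)).contDiffAt (hU.mem_nhds hqU)).continuousAt
    exact h1.continuousWithinAt.clm_apply (hν.continuousOn q hq)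
  have hσq : σ q ≠ 0 := (hg q hq hqU).1
  have hpos : ∀ᶠ x in 𝓝[S] q, 0 < σ x * σ q :=
    (hσ.mul continuousWithinAt_const).eventually_const_lt (mul_self_pos.2 hσq)
  rw [eventually_nhdsWithin_iff] at hpos
  refine ⟨U ∩ {x | x ∈ S → 0 < σ x * σ q}, inter_mem (hU.mem_nhds hqU) hpos,
    fun x => (σ q / |σ q|) • (‖gradient F x‖⁻¹ • gradient F x), ?_, fun y hy => ?_⟩
  · have hg' := ContDiffOn.gradient hU hF
    have hg0 : ∀ y ∈ U, gradient F y ≠ 0 := fun y hy h => hF' y hy (by simpa [gradient] using h)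
    have : ContDiffOn ℝ ∞ (fun x => (σ q / |σ q|) • (‖gradient F x‖⁻¹ • gradient F x)) U :=
      ((((hg'.norm ℝ hg0).inv fun x hx => norm_ne_zero_iff.2 (hg0 x hx)).smul hg').const_smul _)
    exact (this.mono inter_subset_left).contMDiffOn
  · dsimp only
    split_ifs with hyS
    swap
    · trivial
    have hpos := hy.2 hyS
    change _ = _
    rw [(hg y hyS hy.1).2]
    change (σ q / |σ q|) • (‖σ y • ν y‖⁻¹ • (σ y • ν y)) = ν y
    rw [norm_smul, hν.norm_eq_one y hyS, mul_one, smul_smul, smul_smul, Real.norm_eq_abs]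
    have : σ q / |σ q| * (|σ y|⁻¹ * σ y) = 1 := by
      rw [show σ q / |σ q| * (|σ y|⁻¹ * σ y) = (σ y * σ q) / (|σ y| * |σ q|) by ring,
        ← abs_mul, abs_of_pos hpos, div_self hpos.ne']
    rw [mul_assoc, this, one_smul]

end Normal

/-! ### Cross product identities and the frame `(n, v, n × v)`. -/

section Cross

theorem inner_self_cross (a b : E3) : ⟪a, cross a b⟫ = 0 := by
  simp [cross, PiLp.inner_apply, Fin.sum_univ_three, cross_apply]
  ring

theorem inner_cross_self (a b : E3) : ⟪b, cross a b⟫ = 0 := by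
  simp [cross, PiLp.inner_apply, Fin.sum_univ_three, cross_apply]
  ring

theorem inner_cross_cross (a b c d : E3) :
    ⟪cross a b, cross c d⟫ = ⟪a, c⟫ * ⟪b, d⟫ - ⟪a, d⟫ * ⟪b, c⟫ := by
  simp [cross, PiLp.inner_apply, Fin.sum_univ_three, cross_apply]
  ring

theorem cross_cross_eq (a b : E3) : cross a (cross a b) = ⟪a, b⟫ • a - ⟪a, a⟫ • b := by
  ext i
  fin_cases i <;>
    simp [cross, PiLp.inner_apply, Fin.sum_univ_three, cross_apply,
      -inner_self_eq_norm_sq_to_K] <;> ring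

theorem cross_add_right (a b c : E3) : cross a (b + c) = cross a b + cross a c := by
  simp [cross]

theorem cross_smul_right (a b : E3) (r : ℝ) : cross a (r • b) = r • cross a b := by
  simp [cross]

theorem contDiff_cross {n : WithTop ℕ∞} : ContDiff ℝ n fun z : E3 × E3 => cross z.1 z.2 := by
  rw [contDiff_euclidean]
  intro i
  fin_cases i <;> simp [cross, cross_apply] <;> fun_prop

/-- `(n, v, n × v)` is an orthonormal frame if `n` and `v` are orthogonal unit vectors. -/
theorem norm_cross_eq_one {n v : E3} (hn : ‖n‖ = 1) (hv : ‖v‖ = 1) (h : ⟪n, v⟫ = 0) :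
    ‖cross n v‖ = 1 := by
  have : ‖cross n v‖ ^ 2 = 1 := by
    rw [← real_inner_self_eq_norm_sq, inner_cross_cross, real_inner_self_eq_norm_sq,
      real_inner_self_eq_norm_sq, hn, hv, h]
    norm_num
  nlinarith [norm_nonneg (cross n v)]

theorem eq_sum_frame {n v : E3} (hn : ‖n‖ = 1) (hv : ‖v‖ = 1) (h : ⟪n, v⟫ = 0) (w : E3) :
    w = ⟪n, w⟫ • n + ⟪v, w⟫ • v + ⟪cross n v, w⟫ • cross n v := by
  have hc := norm_cross_eq_one hn hv h
  have hon : Orthonormal ℝ ![n, v, cross n v] := by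
    have h1 := inner_self_cross n v
    have h2 := inner_cross_self n v
    refine ⟨fun i => by fin_cases i <;> simp [hn, hv, hc], fun i j hij => ?_⟩
    fin_cases i <;> fin_cases j <;>
      simp_all [real_inner_comm n v, real_inner_comm n (cross n v), real_inner_comm v (cross n v)]
  let b := OrthonormalBasis.mk hon (by
    have := (basisOfOrthonormalOfCardEqFinrank hon (by simp)).span_eq
    rw [coe_basisOfOrthonormalOfCardEqFinrank] at this
    exact this.ge)
  have := b.sum_repr' w
  simp only [b, OrthonormalBasis.coe_mk, Fin.sum_univ_three] at this
  simpa using this.symm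

end Cross

/-! ### The shape operator and the Gauss curvature through the extension `G`. -/

section Shape

/-- The expression of the Gauss curvature through an extension `G` of the Gauss map. -/
def shapeDet (G : E3 → E3) (z : E3 × E3) : ℝ :=
  ⟪fderiv ℝ G z.1 z.2, z.2⟫ * ⟪fderiv ℝ G z.1 (cross (G z.1) z.2), cross (G z.1) z.2⟫ -
    ⟪fderiv ℝ G z.1 z.2, cross (G z.1) z.2⟫ * ⟪fderiv ℝ G z.1 (cross (G z.1) z.2), z.2⟫

theorem contDiff_shapeDet {G : E3 → E3} (hG : ContDiff ℝ ∞ G) : ContDiff ℝ ∞ (shapeDet G) := by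
  have hD : ContDiff ℝ ∞ fun z : E3 × E3 => fderiv ℝ G z.1 :=
    (hG.fderiv_right (m := ∞) (by simp)).comp contDiff_fst
  have hn : ContDiff ℝ ∞ fun z : E3 × E3 => cross (G z.1) z.2 :=
    contDiff_cross.comp ((hG.comp contDiff_fst).prodMk contDiff_snd)
  have h1 := hD.clm_apply (contDiff_snd (𝕜 := ℝ) (E := E3) (F := E3))
  have h2 := hD.clm_apply hn
  exact ((h1.inner ℝ contDiff_snd).mul (h2.inner ℝ hn)).sub
    ((h1.inner ℝ hn).mul (h2.inner ℝ contDiff_snd))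

variable {S : Set E3} {ν : E3 → E3} {G : E3 → E3}

theorem hasFDerivWithinAt_normal (hG : ContDiff ℝ ∞ G) (hGν : EqOn G ν S) {q : E3} (hq : q ∈ S) :
    HasFDerivWithinAt ν (fderiv ℝ G q) S q :=
  ((hG.differentiable (by simp)) q).hasFDerivAt.hasFDerivWithinAt.congr
    (fun x hx => (hGν hx).symm) (hGν hq).symm

/-- A surface is not a set of unique differentiability in space; two derivatives within `S` need
only agree on its tangent cone, whence the condition on `a`. -/
theorem fderivWithin_normal_apply (hS : IsSmoothSurface S) (hν : IsUnitNormalField S ν)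
    (hG : ContDiff ℝ ∞ G) (hGν : EqOn G ν S) {q a : E3} (hq : q ∈ S) (ha : ⟪ν q, a⟫ = 0) :
    fderivWithin ℝ ν S q a = fderiv ℝ G q a := by
  have h := hasFDerivWithinAt_normal hG hGν hq
  exact h.differentiableWithinAt.hasFDerivWithinAt.unique_on h
    (mem_tangentConeAt_of_inner_eq_zero hS hν hq ha)

/-- Differentiate `⟪G, G⟫ = 1`, which is known only on `S`, in a tangent direction. -/
theorem inner_fderiv_normal (hS : IsSmoothSurface S) (hν : IsUnitNormalField S ν)
    (hG : ContDiff ℝ ∞ G) (hGν : EqOn G ν S) {q a : E3} (hq : q ∈ S) (ha : ⟪ν q, a⟫ = 0) :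
    ⟪fderiv ℝ G q a, ν q⟫ = 0 := by
  have hd := ((hG.differentiable (by simp)) q).hasFDerivAt
  have h1 : HasFDerivWithinAt (fun x => ⟪G x, G x⟫)
      ((fderivInnerCLM ℝ (G q, G q)).comp ((fderiv ℝ G q).prod (fderiv ℝ G q))) S q :=
    (hd.inner ℝ hd).hasFDerivWithinAt
  have h2 : HasFDerivWithinAt (fun x => ⟪G x, G x⟫) (0 : E3 →L[ℝ] ℝ) S q := by
    refine (hasFDerivWithinAt_const (1 : ℝ) q S).congr (fun x hx => ?_) ?_
    · rw [hGν hx, real_inner_self_eq_norm_sq, hν.norm_eq_one x hx, one_pow]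
    · rw [hGν hq, real_inner_self_eq_norm_sq, hν.norm_eq_one q hq, one_pow]
  have := h1.unique_on h2 (mem_tangentConeAt_of_inner_eq_zero hS hν hq ha)
  simp [fderivInnerCLM_apply, real_inner_comm] at this
  rw [← hGν hq, real_inner_comm]
  linarith

/-- The shape operator is symmetric. -/
theorem inner_fderiv_comm (hS : IsSmoothSurface S) (hν : IsUnitNormalField S ν)
    (hG : ContDiff ℝ ∞ G) (hGν : EqOn G ν S) {q a b : E3} (hq : q ∈ S) (ha : ⟪ν q, a⟫ = 0)
    (hb : ⟪ν q, b⟫ = 0) : ⟪fderiv ℝ G q a, b⟫ = ⟪fderiv ℝ G q b, a⟫ := by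
  obtain ⟨U, hU, hqU, F, hF, hF', hSU, hg⟩ := exists_local_equation hS hν hq
  have hUq := hU.mem_nhds hqU
  have hDF : HasFDerivAt (fderiv ℝ F) (fderiv ℝ (fderiv ℝ F) q) q :=
    (((hF.fderiv_of_isOpen hU (m := ∞) (by simp)).contDiffAt hUq).differentiableAt
      (by simp)).hasFDerivAt
  have hd := ((hG.differentiable (by simp)) q).hasFDerivAt
  let μ : E3 → ℝ := fun x => fderiv ℝ F x (G x)
  have hμd : DifferentiableAt ℝ μ q :=
    hDF.differentiableAt.clm_apply hd.differentiableAt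
  have hμq : μ q ≠ 0 := by
    have := (hg q hq hqU).1
    rwa [← hGν hq] at this
  -- On `S` one has `dF(b) = μ ⟪G, b⟫`. Differentiating along `a`, the term with `dμ` drops out
  -- because `b` is tangent at `q`; the second fundamental form is thus a multiple of the symmetric
  -- Hessian of `F`.
  have key : ∀ a b : E3, ⟪ν q, a⟫ = 0 → ⟪ν q, b⟫ = 0 →
      fderiv ℝ (fderiv ℝ F) q a b = μ q * ⟪fderiv ℝ G q a, b⟫ := by
    intro a b ha hb
    have h1 : HasFDerivWithinAt (fun x => fderiv ℝ F x b)
        ((fderiv ℝ (fderiv ℝ F) q).flip b) (S ∩ U) q := by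
      have := (hDF.clm_apply (hasFDerivAt_const b q)).hasFDerivWithinAt (s := S ∩ U)
      simpa using this
    have h2 : HasFDerivWithinAt (fun x => fderiv ℝ F x b) (μ q • ((fderivInnerCLM ℝ (G q, b)).comp
        ((fderiv ℝ G q).prod 0)) + ⟪G q, b⟫ • fderiv ℝ μ q) (S ∩ U) q := by
      refine ((hμd.hasFDerivAt.mul (hd.inner ℝ
        (hasFDerivAt_const b q))).hasFDerivWithinAt).congr (fun x hx => ?_) ?_
      · rw [← inner_gradient_eq, (hg x hx.1 hx.2).2, inner_smul_left, ← hGν hx.1]; rfl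
      · rw [← inner_gradient_eq, (hg q hq hqU).2, inner_smul_left, ← hGν hq]; rfl
    have ht : a ∈ tangentConeAt ℝ (S ∩ U) q := by
      rw [tangentConeAt_inter_nhds hUq]
      exact mem_tangentConeAt_of_inner_eq_zero hS hν hq ha
    have := h1.unique_on h2 ht
    simpa [fderivInnerCLM_apply, hGν hq, hb] using this
  have hsymm : fderiv ℝ (fderiv ℝ F) q a b = fderiv ℝ (fderiv ℝ F) q b a :=
    ((hF.contDiffAt hUq).isSymmSndFDerivAt (by
      rw [minSmoothness_of_isRCLikeNormedField]; exact WithTop.coe_le_coe.2 (le_top (a := (2 : ℕ∞))))) a b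
  rw [key a b ha hb, key b a hb ha] at hsymm
  exact mul_left_cancel₀ hμq hsymm

/-- The Gauss curvature in terms of an orthonormal frame `(v, ν × v)`. -/
theorem gaussCurvature_eq_shapeDet (hS : IsSmoothSurface S) (hν : IsUnitNormalField S ν)
    (hG : ContDiff ℝ ∞ G) (hGν : EqOn G ν S) {q v : E3} (hq : q ∈ S) (hv1 : ‖v‖ = 1)
    (hv : ⟪ν q, v⟫ = 0) : gaussCurvature S ν q = shapeDet G (q, v) := by
  have hn1 := hν.norm_eq_one q hq
  set n := cross (ν q) v with hn
  have hnν : ⟪ν q, n⟫ = 0 := inner_self_cross _ _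
  have hnv : ⟪v, n⟫ = 0 := inner_cross_self _ _
  have hnn : ‖n‖ = 1 := norm_cross_eq_one hn1 hv1 hv
  have mem : ∀ w : E3, ⟪ν q, w⟫ = 0 → w ∈ tangentPlane ν q := fun w hw =>
    Submodule.mem_orthogonal_singleton_iff_inner_right.2 hw
  let b0 : Fin 2 → tangentPlane ν q := ![⟨v, mem v hv⟩, ⟨n, mem n hnν⟩]
  have hon : Orthonormal ℝ b0 := by
    refine ⟨fun i => by fin_cases i <;> simp [b0, hv1, hnn], fun i j hij => ?_⟩
    have hnv' : ⟪n, v⟫ = 0 := (real_inner_comm v n).trans hnv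
    fin_cases i <;> fin_cases j
    exacts [absurd rfl hij, hnv, hnv', absurd rfl hij]
  let b : OrthonormalBasis (Fin 2) ℝ (tangentPlane ν q) := OrthonormalBasis.mk hon (by
    rintro ⟨w, hw⟩ -
    have hw' : ⟪ν q, w⟫ = 0 := Submodule.mem_orthogonal_singleton_iff_inner_right.1 hw
    have := eq_sum_frame hn1 hv1 hv w
    rw [hw', zero_smul, zero_add] at this
    have e : (⟨w, hw⟩ : tangentPlane ν q) = ⟪v, w⟫ • b0 0 + ⟪n, w⟫ • b0 1 :=
      Subtype.ext (by simpa [b0] using this)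
    rw [e]
    exact Submodule.add_mem _ (Submodule.smul_mem _ _ (Submodule.subset_span ⟨0, rfl⟩))
      (Submodule.smul_mem _ _ (Submodule.subset_span ⟨1, rfl⟩)))
  have entry : ∀ x y : tangentPlane ν q,
      ⟪x, gaussMapDeriv S ν q y⟫ = ⟪fderiv ℝ G q (y : E3), (x : E3)⟫ := by
    intro x y
    have hy : ⟪ν q, (y : E3)⟫ = 0 := Submodule.mem_orthogonal_singleton_iff_inner_right.1 y.2
    rw [← fderivWithin_normal_apply hS hν hG hGν hq hy, real_inner_comm]
    exact Submodule.inner_orthogonalProjectionOnto_eq_of_mem_right x _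
  rw [gaussCurvature, ← LinearMap.det_toMatrix b.toBasis, Matrix.det_fin_two]
  have hb0 : b 0 = ⟨v, mem v hv⟩ := by simp [b, b0]
  have hb1 : b 1 = ⟨n, mem n hnν⟩ := by simp [b, b0]
  have hm := LinearMap.toMatrixOrthonormal_apply_apply b (gaussMapDeriv S ν q)
  change ∀ i j, LinearMap.toMatrix b.toBasis b.toBasis (gaussMapDeriv S ν q) i j = _ at hm
  rw [hm, hm, hm, hm, entry, entry, entry, entry, hb0, hb1]
  simp only [shapeDet, hGν hq, ← hn]
  ring

end Shape

/-! ### Geodesics as integral curves in the unit tangent bundle. -/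

section Geodesics

/-- The geodesic equation as a first order system, for an extension `G` of the Gauss map. -/
def geodesicField (G : E3 → E3) (z : E3 × E3) : E3 × E3 :=
  (z.2, (-⟪fderiv ℝ G z.1 z.2, z.2⟫) • G z.1)

/-- The unit tangent bundle of `S`. -/
def unitTangents (S : Set E3) (ν : E3 → E3) : Set (E3 × E3) :=
  {z | z.1 ∈ S ∧ ‖z.2‖ = 1 ∧ ⟪ν z.1, z.2⟫ = 0}

variable {S : Set E3} {ν : E3 → E3} {G : E3 → E3}

theorem contDiff_geodesicField (hG : ContDiff ℝ ∞ G) : ContDiff ℝ ∞ (geodesicField G) := by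
  have hD : ContDiff ℝ ∞ fun z : E3 × E3 => fderiv ℝ G z.1 :=
    (hG.fderiv_right (m := ∞) (by simp)).comp contDiff_fst
  exact contDiff_snd.prodMk
    (((hD.clm_apply contDiff_snd).inner ℝ contDiff_snd).neg.smul (hG.comp contDiff_fst))

/-- This compact phase space is the source of every uniform bound: on geodesics, on their velocities
and on the curvature. -/
theorem isCompact_unitTangents (hS : IsCompact S) (hG : ContDiff ℝ ∞ G) (hGν : EqOn G ν S) :
    IsCompact (unitTangents S ν) := by
  have : unitTangents S ν = (S ×ˢ closedBall (0 : E3) 1) ∩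
      {z | ‖z.2‖ = 1 ∧ ⟪G z.1, z.2⟫ = 0} := by
    ext z
    constructor
    · rintro ⟨h1, h2, h3⟩
      exact ⟨⟨h1, by simp [h2]⟩, h2, by rwa [hGν h1]⟩
    · rintro ⟨⟨h1, -⟩, h2, h3⟩
      exact ⟨h1, h2, by rwa [← hGν h1]⟩
  rw [this]
  refine (hS.prod (isCompact_closedBall _ _)).inter_right (IsClosed.and ?_ ?_)
  · exact isClosed_eq (by fun_prop) continuous_const
  · exact isClosed_eq ((hG.continuous.comp continuous_fst).inner continuous_snd) continuous_const

/-- Differentiating `⟪G(γ), γ'⟫ = 0` determines the normal coefficient `c` of the acceleration. -/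
theorem hasDerivAt_geodesicField (hν : IsUnitNormalField S ν) (hG : ContDiff ℝ ∞ G)
    (hGν : EqOn G ν S) {γ γ' : ℝ → E3} {t c : ℝ}
    (h : ∀ᶠ r in 𝓝 t, γ r ∈ S ∧ HasDerivAt γ (γ' r) r) (h' : HasDerivAt γ' (c • ν (γ t)) t) :
    HasDerivAt (fun r => (γ r, γ' r)) (geodesicField G (γ t, γ' t)) t := by
  have hγ := h.self_of_nhds.2
  have hS := h.self_of_nhds.1
  refine hγ.prodMk ?_
  have hz : ∀ᶠ r in 𝓝 t, ⟪G (γ r), γ' r⟫ = 0 := by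
    filter_upwards [h.eventually_nhds] with r hr
    rw [hGν hr.self_of_nhds.1]
    exact inner_normal_deriv_eq_zero hν (hr.mono fun _ h => h.1) hr.self_of_nhds.2
  have hGd : HasDerivAt (fun r => G (γ r)) (fderiv ℝ G (γ t) (γ' t)) t :=
    ((hG.differentiable (by simp)) (γ t)).hasFDerivAt.comp_hasDerivAt t hγ
  have h1 := hGd.inner ℝ h'
  have h2 : HasDerivAt (fun r => ⟪G (γ r), γ' r⟫) 0 t :=
    (hasDerivAt_const t (0 : ℝ)).congr_of_eventuallyEq hz
  have h3 := h1.unique h2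
  rw [inner_smul_right, hGν hS, real_inner_self_eq_norm_sq, hν.norm_eq_one _ hS] at h3
  have : c = -⟪fderiv ℝ G (γ t) (γ' t), γ' t⟫ := by linarith
  rw [hGν hS, ← this]
  exact h'

theorem hasDerivAt_inner_velocity (hν : IsUnitNormalField S ν) {γ γ' : ℝ → E3} {t c : ℝ}
    (h : ∀ᶠ r in 𝓝 t, γ r ∈ S) (hγ : HasDerivAt γ (γ' t) t)
    (h' : HasDerivAt γ' (c • ν (γ t)) t) : HasDerivAt (fun r => ⟪γ' r, γ' r⟫) 0 t := by
  have h1 := h'.inner ℝ h'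
  have h0 := inner_normal_deriv_eq_zero hν h hγ
  rw [inner_smul_right, inner_smul_left, real_inner_comm, h0] at h1
  simpa using h1

/-- Cutting off the geodesic field outside a large ball makes it complete. The times at which the
resulting curve lies in the unit tangent bundle form a clopen set: closed by compactness, open
because a local geodesic in `S` solves the same equation and uniqueness identifies the two. So the
curve never leaves the bundle, where the cutoff has no effect. -/
theorem exists_geodesic (hS : IsSmoothSurface S) (hν : IsUnitNormalField S ν) (hc : IsCompact S)
    {p v : E3} (hp : p ∈ S) (hv1 : ‖v‖ = 1) (hv : ⟪ν p, v⟫ = 0) :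
    ∃ γ, IsGeodesic S ν γ ∧ γ 0 = p ∧ deriv γ 0 = v := by
  obtain ⟨G, hG, hGν⟩ := exists_contDiff_extension hS hν hc.isClosed
  have hK := isCompact_unitTangents hc hG hGν
  obtain ⟨r, hr0, hr⟩ := hK.isBounded.exists_pos_norm_le
  let b : ContDiffBump (0 : E3 × E3) := ⟨r + 1, r + 2, by positivity, by linarith⟩
  let f : E3 × E3 → E3 × E3 := fun z => b z • geodesicField G z
  have hf : ContDiff ℝ 1 f := b.contDiff.smul ((contDiff_geodesicField hG).of_le (by simp))
  have hfc : HasCompactSupport f := b.hasCompactSupport.smul_right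
  have hf1 : ∀ z ∈ unitTangents S ν, f z = geodesicField G z := fun z hz => by
    have : b z = 1 := b.one_of_mem_closedBall (by
      rw [mem_closedBall_zero_iff]; exact (hr z hz).trans (lt_add_one r).le)
    simp [f, this]
  obtain ⟨L, hL⟩ := ContDiff.lipschitzWith_of_hasCompactSupport hfc hf one_ne_zero
  obtain ⟨u, hu0, hu⟩ := exists_global_solution_of_hasCompactSupport hf hfc (p, v)
  have huc : Continuous u := continuous_iff_continuousAt.2 fun t => (hu t).continuousAt
  have hclopen : IsClopen (u ⁻¹' unitTangents S ν) := by
    refine ⟨hK.isClosed.preimage huc, isOpen_iff_mem_nhds.2 fun t₀ ht₀ => ?_⟩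
    obtain ⟨γ, γ', h0, h0', hγ⟩ := exists_local_geodesic hS hν ht₀.1 ht₀.2.2
    obtain ⟨δ, hδ, hball⟩ := Metric.eventually_nhds_iff_ball.1 hγ
    have hev : ∀ r ∈ ball (0 : ℝ) δ, ∀ᶠ s in 𝓝 r, γ s ∈ S ∧ HasDerivAt γ (γ' s) s := fun r hr =>
      (isOpen_ball.eventually_mem hr).mono fun s hs => ⟨(hball s hs).1, (hball s hs).2.1⟩
    have hnorm : ∀ r ∈ ball (0 : ℝ) δ, ‖γ' r‖ = 1 := by
      intro r hr
      have := (convex_ball (0 : ℝ) δ).norm_image_sub_le_of_norm_hasDerivWithin_le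
        (f := fun s => ⟪γ' s, γ' s⟫) (f' := fun _ => 0) (C := 0) (fun s hs => by
          obtain ⟨c, hc⟩ := (hball s hs).2.2
          exact (hasDerivAt_inner_velocity hν ((hev s hs).mono fun _ h => h.1) (hball s hs).2.1
            hc).hasDerivWithinAt) (by simp) (mem_ball_self hδ) hr
      rw [h0', real_inner_self_eq_norm_sq, real_inner_self_eq_norm_sq, ht₀.2.1, zero_mul,
        norm_le_zero_iff] at this
      nlinarith [norm_nonneg (γ' r)]
    have hmem : ∀ r ∈ ball (0 : ℝ) δ, (γ r, γ' r) ∈ unitTangents S ν := fun r hr =>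
      ⟨(hball r hr).1, hnorm r hr,
        inner_normal_deriv_eq_zero hν ((hev r hr).mono fun _ h => h.1) (hball r hr).2.1⟩
    have hsol : ∀ r ∈ ball (0 : ℝ) δ, HasDerivAt (fun s => (γ s, γ' s)) (f (γ r, γ' r)) r := by
      intro r hr
      rw [hf1 _ (hmem r hr)]
      obtain ⟨c, hc⟩ := (hball r hr).2.2
      exact hasDerivAt_geodesicField hν hG hGν (hev r hr) hc
    have hshift : ∀ᶠ s in 𝓝 t₀, s - t₀ ∈ ball (0 : ℝ) δ := by
      filter_upwards [ball_mem_nhds t₀ hδ] with s hs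
      rwa [mem_ball_zero_iff, ← dist_eq_norm]
    have := ODE_solution_unique_of_eventually (v := fun _ => f) (K := L) (s := fun _ => univ)
      (f := u) (g := fun s => (γ (s - t₀), γ' (s - t₀))) (t₀ := t₀)
      (Eventually.of_forall fun _ => hL.lipschitzOnWith)
      (Eventually.of_forall fun s => ⟨hu s, trivial⟩)
      (hshift.mono fun s hs => ⟨(hsol _ hs).comp_sub_const s t₀, trivial⟩)
      (by rw [sub_self, h0, h0'])
    filter_upwards [this, hshift] with s h1 h2
    rw [mem_preimage, h1]
    exact hmem _ h2
  have hmem : ∀ t, u t ∈ unitTangents S ν := by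
    have h := hclopen.eq_univ ⟨0, by rw [mem_preimage, hu0]; exact ⟨hp, hv1, hv⟩⟩
    intro t
    have : t ∈ u ⁻¹' unitTangents S ν := by rw [h]; trivial
    exact this
  have hd1 : ∀ t, HasDerivAt (fun t => (u t).1) (u t).2 t := fun t => by
    have := (hu t).fst
    rwa [hf1 _ (hmem t)] at this
  have hd2 : ∀ t, HasDerivAt (fun t => (u t).2) (geodesicField G (u t)).2 t := fun t => by
    have := (hu t).snd
    rwa [hf1 _ (hmem t)] at this
  have hderiv : deriv (fun t => (u t).1) = fun t => (u t).2 := funext fun t => (hd1 t).deriv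
  have hderiv2 : deriv (fun t => (u t).2) = fun t => (geodesicField G (u t)).2 :=
    funext fun t => (hd2 t).deriv
  refine ⟨fun t => (u t).1, ⟨?_, fun t => (hmem t).1, fun t => ?_⟩, by simp [hu0], by
    rw [hderiv]; simp [hu0]⟩
  · rw [show (2 : WithTop ℕ∞) = 1 + 1 by norm_num, contDiff_succ_iff_deriv]
    refine ⟨fun t => (hd1 t).differentiableAt, by simp, ?_⟩
    rw [hderiv, contDiff_one_iff_deriv]
    refine ⟨fun t => (hd2 t).differentiableAt, ?_⟩
    rw [hderiv2]
    exact continuous_snd.comp ((contDiff_geodesicField hG).continuous.comp huc)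
  · rw [covDeriv, hderiv, hderiv2]
    have hS := (hmem t).1
    simp only [geodesicField, hGν hS]
    rw [inner_smul_left, real_inner_self_eq_norm_sq, hν.norm_eq_one _ hS]
    simp

theorem IsGeodesic.hasDerivAt {γ : ℝ → E3} (h : IsGeodesic S ν γ) (t : ℝ) :
    HasDerivAt γ (deriv γ t) t :=
  ((h.contDiff.differentiable (by simp)) t).hasDerivAt

theorem IsGeodesic.hasDerivAt_deriv {γ : ℝ → E3} (h : IsGeodesic S ν γ) (t : ℝ) :
    HasDerivAt (deriv γ) (⟪deriv (deriv γ) t, ν (γ t)⟫ • ν (γ t)) t := by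
  have h2 : ContDiff ℝ (1 + 1) γ := by
    rw [show (1 + 1 : WithTop ℕ∞) = 2 by norm_num]; exact h.contDiff
  have h1 := ((contDiff_succ_iff_deriv.1 h2).2.2.differentiable (by simp) t).hasDerivAt
  rwa [sub_eq_zero.1 (h.covDeriv_eq_zero t)] at h1

theorem IsGeodesic.hasDerivAt_geodesicField {γ : ℝ → E3} (h : IsGeodesic S ν γ)
    (hν : IsUnitNormalField S ν) (hG : ContDiff ℝ ∞ G) (hGν : EqOn G ν S) (t : ℝ) :
    HasDerivAt (fun r => (γ r, deriv γ r)) (geodesicField G (γ t, deriv γ t)) t :=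
  ConjLocus.hasDerivAt_geodesicField hν hG hGν
    (Eventually.of_forall fun r => ⟨h.mem r, h.hasDerivAt r⟩) (h.hasDerivAt_deriv t)

theorem IsGeodesic.inner_eq_zero {γ : ℝ → E3} (h : IsGeodesic S ν γ)
    (hν : IsUnitNormalField S ν) (t : ℝ) : ⟪ν (γ t), deriv γ t⟫ = 0 :=
  inner_normal_deriv_eq_zero hν (Eventually.of_forall h.mem) (h.hasDerivAt t)

theorem IsGeodesic.norm_deriv_eq {γ : ℝ → E3} (h : IsGeodesic S ν γ)
    (hν : IsUnitNormalField S ν) (t : ℝ) : ‖deriv γ t‖ = ‖deriv γ 0‖ := by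
  have hd : ∀ t, HasDerivAt (fun r => ⟪deriv γ r, deriv γ r⟫) 0 t := fun t =>
    hasDerivAt_inner_velocity hν (Eventually.of_forall h.mem) (h.hasDerivAt t)
      (h.hasDerivAt_deriv t)
  have := is_const_of_deriv_eq_zero (fun t => (hd t).differentiableAt) (fun t => (hd t).deriv) t 0
  simp only [real_inner_self_eq_norm_sq] at this
  exact (pow_left_inj₀ (norm_nonneg _) (norm_nonneg _) two_ne_zero).1 this

end Geodesics

/-! ### Scalar Jacobi fields and their first positive zero. -/

section Jacobi

variable {k y : ℝ → ℝ}

theorem exists_isScalarJacobi (hk : Continuous k) : ∃ y, IsScalarJacobi k y := by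
  let A : ℝ → (ℝ × ℝ) →L[ℝ] (ℝ × ℝ) := fun t =>
    (ContinuousLinearMap.snd ℝ ℝ ℝ).prod 0 -
      k t • (0 : (ℝ × ℝ) →L[ℝ] ℝ).prod (ContinuousLinearMap.fst ℝ ℝ ℝ)
  have hA : Continuous A := by fun_prop
  obtain ⟨u, hu0, hu⟩ := exists_global_solution_linear hA (0, 1)
  have huc : Continuous u := continuous_iff_continuousAt.2 fun t => (hu t).continuousAt
  have hd1 : ∀ t, HasDerivAt (fun t => (u t).1) (u t).2 t := fun t =>
    HasDerivAt.congr_deriv (f' := (A t (u t)).1) (hu t).fst (by simp [A])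
  have hd2 : ∀ t, HasDerivAt (fun t => (u t).2) (-k t * (u t).1) t := fun t =>
    HasDerivAt.congr_deriv (f' := (A t (u t)).2) (hu t).snd (by simp [A])
  have hderiv : deriv (fun t => (u t).1) = fun t => (u t).2 := funext fun t => (hd1 t).deriv
  have hderiv2 : deriv (fun t => (u t).2) = fun t => -k t * (u t).1 :=
    funext fun t => (hd2 t).deriv
  refine ⟨fun t => (u t).1, ?_, by simp [hu0], by rw [hderiv]; simp [hu0], fun s => by
    rw [hderiv, hderiv2]; ring⟩
  rw [show (2 : WithTop ℕ∞) = 1 + 1 by norm_num, contDiff_succ_iff_deriv]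
  refine ⟨fun t => (hd1 t).differentiableAt, by simp, ?_⟩
  rw [hderiv, contDiff_one_iff_deriv]
  refine ⟨fun t => (hd2 t).differentiableAt, ?_⟩
  rw [hderiv2]
  fun_prop

theorem IsScalarJacobi.hasDerivAt (h : IsScalarJacobi k y) (s : ℝ) :
    HasDerivAt y (deriv y s) s :=
  ((h.contDiff.differentiable (by simp)) s).hasDerivAt

theorem IsScalarJacobi.hasDerivAt_deriv (h : IsScalarJacobi k y) (s : ℝ) :
    HasDerivAt (deriv y) (-k s * y s) s := by
  have h2 : ContDiff ℝ (1 + 1) y := by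
    rw [show (1 + 1 : WithTop ℕ∞) = 2 by norm_num]; exact h.contDiff
  have h1 := ((contDiff_succ_iff_deriv.1 h2).2.2.differentiable (by simp) s).hasDerivAt
  rwa [show deriv (deriv y) s = -k s * y s by linarith [h.equation s]] at h1

theorem IsScalarJacobi.continuous (h : IsScalarJacobi k y) : Continuous y := h.contDiff.continuous

/-- The bound involves only `C` and `M`, so it is uniform over a family of geodesics with a common
curvature bound. -/
theorem IsScalarJacobi.norm_le (h : IsScalarJacobi k y) {C : ℝ} (hC : ∀ s, |k s| ≤ C) (M : ℝ) :
    ∀ s ∈ Icc (-M) M, ‖(y s, deriv y s)‖ ≤ Real.exp ((1 + C) * (M + 1)) := by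
  have hC0 : 0 ≤ C := (abs_nonneg _).trans (hC 0)
  intro s hs
  have := norm_le_mul_exp_of_norm_deriv_le (w := fun s => (y s, deriv y s))
    (w' := fun s => (deriv y s, -k s * y s)) (T := M + 1) (L := 1 + C) (by positivity)
    (fun t _ => (h.hasDerivAt t).prodMk (h.hasDerivAt_deriv t)) (fun t _ => ?_) s
    ⟨by linarith [hs.1], by linarith [hs.2]⟩
  · simpa [h.zero, h.deriv_zero] using this
  · have h1 : ‖y t‖ ≤ ‖(y t, deriv y t)‖ := norm_fst_le (y t, deriv y t)
    have h2 : ‖deriv y t‖ ≤ ‖(y t, deriv y t)‖ := norm_snd_le (y t, deriv y t)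
    refine max_le ?_ ?_
    · change ‖deriv y t‖ ≤ _
      nlinarith [norm_nonneg (y t, deriv y t)]
    · change ‖-k t * y t‖ ≤ _
      rw [norm_mul, norm_neg]
      calc ‖k t‖ * ‖y t‖ ≤ C * ‖(y t, deriv y t)‖ := by
            gcongr; exact hC t
        _ ≤ _ := by nlinarith [norm_nonneg (y t, deriv y t)]

/-- A scalar Jacobi field has no double zeros. -/
theorem IsScalarJacobi.deriv_ne_zero (h : IsScalarJacobi k y) {C : ℝ} (hC : ∀ s, |k s| ≤ C)
    {s : ℝ} (hs : y s = 0) : deriv y s ≠ 0 := by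
  have hC0 : 0 ≤ C := (abs_nonneg _).trans (hC 0)
  intro hs'
  -- Gronwall started at the double zero `s` and run to time `0` forces `y'(0) = 0`, against `y'(0)
  -- = 1`.
  have := norm_le_mul_exp_of_norm_deriv_le (w := fun r => (y (r + s), deriv y (r + s)))
    (w' := fun r => (deriv y (r + s), -k (r + s) * y (r + s))) (T := |s| + 1) (L := 1 + C)
    (by positivity)
    (fun t _ => ((h.hasDerivAt _).comp_add_const t s).prodMk
      ((h.hasDerivAt_deriv _).comp_add_const t s)) (fun r _ => ?_) (-s)
    (by rw [mem_Ioo, ← abs_lt, abs_neg]; linarith)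
  · simp [h.zero, h.deriv_zero, hs, hs'] at this
    linarith
  · generalize r + s = t
    have h1 : ‖y t‖ ≤ ‖(y t, deriv y t)‖ := norm_fst_le (y t, deriv y t)
    have h2 : ‖deriv y t‖ ≤ ‖(y t, deriv y t)‖ := norm_snd_le (y t, deriv y t)
    refine max_le ?_ ?_
    · change ‖deriv y t‖ ≤ _
      nlinarith [norm_nonneg (y t, deriv y t)]
    · change ‖-k t * y t‖ ≤ _
      rw [norm_mul, norm_neg]
      calc ‖k t‖ * ‖y t‖ ≤ C * ‖(y t, deriv y t)‖ := by
            gcongr; exact hC t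
        _ ≤ _ := by nlinarith [norm_nonneg (y t, deriv y t)]

theorem IsScalarJacobi.eventually_pos (h : IsScalarJacobi k y) :
    ∃ δ > 0, ∀ s ∈ Ioo 0 δ, 0 < y s := by
  have hc : ContinuousAt (deriv y) 0 := (h.hasDerivAt_deriv 0).continuousAt
  have : ∀ᶠ s in 𝓝 (0 : ℝ), 0 < deriv y s := hc.eventually_const_lt (by simp [h.deriv_zero])
  obtain ⟨δ, hδ, hb⟩ := Metric.eventually_nhds_iff_ball.1 this
  refine ⟨δ, hδ, fun s hs => ?_⟩
  obtain ⟨c, hc, he⟩ := exists_hasDerivAt_eq_slope y (deriv y) hs.1 h.continuous.continuousOn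
    (fun t _ => h.hasDerivAt t)
  have hpos := hb c (by
    rw [mem_ball_zero_iff, Real.norm_of_nonneg hc.1.le]; exact hc.2.trans hs.2)
  rw [he, h.zero, sub_zero, sub_zero] at hpos
  exact (div_pos_iff_of_pos_right hs.1).1 hpos

/-- A scalar Jacobi field stays positive as long as it has no zero. -/
theorem IsScalarJacobi.pos_of_forall_ne_zero (h : IsScalarJacobi k y) {b : ℝ}
    (hb : ∀ s ∈ Ioo 0 b, y s ≠ 0) : ∀ s ∈ Ioo 0 b, 0 < y s := by
  intro s hs
  obtain ⟨δ, hδ, hpos⟩ := h.eventually_pos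
  by_contra hneg
  push Not at hneg
  set r := min (δ / 2) s
  have hr0 : 0 < r := lt_min (by linarith) hs.1
  have hr : 0 < y r := hpos r ⟨hr0, (min_le_left _ _).trans_lt (by linarith)⟩
  obtain ⟨c, hc, he⟩ := intermediate_value_Icc' (min_le_right (δ / 2) s) h.continuous.continuousOn
    ⟨hneg, hr.le⟩
  exact hb c ⟨hr0.trans_le hc.1, hc.2.trans_lt hs.2⟩ he

/-- Sturm comparison: a lower curvature bound forces a zero. -/
theorem IsScalarJacobi.exists_zero (h : IsScalarJacobi k y) {κ : ℝ} (hκ : 0 < κ)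
    (hk : ∀ s, κ ^ 2 ≤ k s) : ∃ s, 0 < s ∧ y s = 0 := by
  by_contra hno
  push Not at hno
  have hpos : ∀ s, 0 < s → 0 < y s := fun s hs =>
    h.pos_of_forall_ne_zero (b := s + 1) (fun r hr => hno r hr.1) s ⟨hs, lt_add_one s⟩
  have hπ : 0 < Real.pi / κ := div_pos Real.pi_pos hκ
  -- The Wronskian of `y` with `sin (κ s)`. If `y` stayed positive it would be nonincreasing on `[0,
  -- π/κ]`, yet it starts at `0` and ends at `κ y(π/κ) > 0`.
  have hW : ∀ s, HasDerivAt (fun s => deriv y s * Real.sin (κ * s) - κ * y s * Real.cos (κ * s))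
      ((κ ^ 2 - k s) * y s * Real.sin (κ * s)) s := by
    intro s
    have hlin : HasDerivAt (fun s : ℝ => κ * s) κ s := by
      simpa using (hasDerivAt_id s).const_mul κ
    have h1 := (h.hasDerivAt_deriv s).mul hlin.sin
    have h2 := ((h.hasDerivAt s).const_mul κ).mul hlin.cos
    refine (h1.sub h2).congr_deriv ?_
    ring
  have hanti : AntitoneOn
      (fun s => deriv y s * Real.sin (κ * s) - κ * y s * Real.cos (κ * s))
      (Icc 0 (Real.pi / κ)) := by
    refine antitoneOn_of_hasDerivWithinAt_nonpos (convex_Icc _ _)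
      (fun s _ => (hW s).continuousAt.continuousWithinAt)
      (fun s _ => (hW s).hasDerivWithinAt) fun s hs => ?_
    rw [interior_Icc] at hs
    have hsin : 0 ≤ Real.sin (κ * s) := Real.sin_nonneg_of_nonneg_of_le_pi
      (mul_nonneg hκ.le hs.1.le) (by
        have := (lt_div_iff₀ hκ).1 hs.2
        rw [mul_comm]; exact this.le)
    have := mul_nonneg (mul_nonneg (sub_nonneg.2 (hk s)) (hpos s hs.1).le) hsin
    nlinarith
  have := hanti ⟨le_rfl, hπ.le⟩ ⟨hπ.le, le_rfl⟩ hπ.le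
  have hcancel : κ * (Real.pi / κ) = Real.pi := mul_div_cancel₀ _ hκ.ne'
  simp [h.zero, hcancel] at this
  nlinarith [mul_pos hκ (hpos _ hπ)]

/-- Positivity just after `0` keeps the positive zeros away from `0`, so they form a closed set and
the infimum is attained. -/
theorem IsScalarJacobi.isLeast_sInf (h : IsScalarJacobi k y) (hz : ∃ s, 0 < s ∧ y s = 0) :
    IsLeast {s | 0 < s ∧ y s = 0} (sInf {s | 0 < s ∧ y s = 0}) := by
  obtain ⟨δ, hδ, hpos⟩ := h.eventually_pos
  have heq : {s | 0 < s ∧ y s = 0} = Ici δ ∩ {s | y s = 0} := by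
    ext s
    constructor
    · rintro ⟨h0, h1⟩
      refine ⟨?_, h1⟩
      by_contra hlt
      exact (hpos s ⟨h0, not_le.1 hlt⟩).ne' h1
    · rintro ⟨h0, h1⟩
      exact ⟨hδ.trans_le h0, h1⟩
  have hcl : IsClosed {s | 0 < s ∧ y s = 0} := by
    rw [heq]
    exact isClosed_Ici.inter (isClosed_eq h.continuous continuous_const)
  exact hcl.isLeast_csInf hz ⟨0, fun s hs => hs.1.le⟩

theorem IsScalarJacobi.pos_of_lt (h : IsScalarJacobi k y) {r : ℝ}
    (hr : IsLeast {s | 0 < s ∧ y s = 0} r) {s : ℝ} (h0 : 0 < s) (hs : s < r) : 0 < y s :=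
  h.pos_of_forall_ne_zero (b := r) (fun _ ht h' => (hr.2 ⟨ht.1, h'⟩).not_gt ht.2) s ⟨h0, hs⟩

/-- Slopes from the left of `r` are nonpositive because `y` is positive there, and a double zero is
excluded. -/
theorem IsScalarJacobi.deriv_neg (h : IsScalarJacobi k y) {C : ℝ} (hC : ∀ s, |k s| ≤ C) {r : ℝ}
    (hr : IsLeast {s | 0 < s ∧ y s = 0} r) : deriv y r < 0 := by
  refine lt_of_le_of_ne ?_ (h.deriv_ne_zero hC hr.1.2)
  have hd := (h.hasDerivAt r).hasDerivWithinAt (s := Iio r)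
  rw [hasDerivWithinAt_iff_tendsto_slope' (by simp)] at hd
  refine le_of_tendsto hd ?_
  filter_upwards [Ioo_mem_nhdsLT hr.1.1] with s hs
  rw [slope_def_field, hr.1.2, sub_zero]
  exact div_nonpos_of_nonneg_of_nonpos (h.pos_of_lt hr hs.1 hs.2).le (by linarith [hs.2])

end Jacobi

/-! ### Chain rule and implicit differentiation along `s = R(ψ)`. -/

section Composition

variable {E : Type*} [NormedAddCommGroup E] [NormedSpace ℝ E]

/-- The mean value inequality in `s` for `f s ψ - s • fs (R ψ₀) ψ₀`; joint continuity of `fs` makes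
its constant small uniformly for `ψ` near `ψ₀`. No derivative in `ψ` is involved. -/
theorem isLittleO_comp_sub {f fs : ℝ → ℝ → E} {R : ℝ → ℝ} {ψ₀ : ℝ}
    (hfs : ContinuousAt (fun q : ℝ × ℝ => fs q.1 q.2) (R ψ₀, ψ₀))
    (hf : ∀ s ψ, HasDerivAt (fun t => f t ψ) (fs s ψ) s) (hR : ContinuousAt R ψ₀) :
    (fun ψ => f (R ψ) ψ - f (R ψ₀) ψ - (R ψ - R ψ₀) • fs (R ψ₀) ψ₀)
      =o[𝓝 ψ₀] fun ψ => R ψ - R ψ₀ := by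
  rw [Asymptotics.isLittleO_iff]
  intro c hc
  have h1 : ∀ᶠ q : ℝ × ℝ in 𝓝 (R ψ₀, ψ₀), ‖fs q.1 q.2 - fs (R ψ₀) ψ₀‖ < c := by
    have : Tendsto (fun q : ℝ × ℝ => ‖fs q.1 q.2 - fs (R ψ₀) ψ₀‖) (𝓝 (R ψ₀, ψ₀)) (𝓝 0) :=
      tendsto_iff_norm_sub_tendsto_zero.1 hfs
    exact this.eventually_lt_const hc
  obtain ⟨δ, hδ, hb⟩ := Metric.eventually_nhds_iff_ball.1 h1
  filter_upwards [hR.eventually (ball_mem_nhds _ hδ), ball_mem_nhds ψ₀ hδ] with ψ h2 h3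
  have hd : ∀ s ∈ ball (R ψ₀) δ, HasDerivWithinAt (fun s => f s ψ - s • fs (R ψ₀) ψ₀)
      (fs s ψ - fs (R ψ₀) ψ₀) (ball (R ψ₀) δ) s := fun s _ => by
    have := ((hf s ψ).sub ((hasDerivAt_id s).smul_const (fs (R ψ₀) ψ₀))).hasDerivWithinAt
      (s := ball (R ψ₀) δ)
    rwa [one_smul] at this
  have := (convex_ball (R ψ₀) δ).norm_image_sub_le_of_norm_hasDerivWithin_le hd (C := c)
    (fun s hs => (hb (s, ψ) (by rw [← ball_prod_same]; exact ⟨hs, h3⟩)).le)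
    (mem_ball_self hδ) h2
  convert this using 2
  rw [sub_smul]; abel

/-- Chain rule for `ψ ↦ f (R ψ) ψ` with a jointly continuous first partial derivative. -/
theorem hasDerivAt_comp_param {f fs : ℝ → ℝ → E} {R : ℝ → ℝ} {ψ₀ R' : ℝ} {z : E}
    (hfs : ContinuousAt (fun q : ℝ × ℝ => fs q.1 q.2) (R ψ₀, ψ₀))
    (hf : ∀ s ψ, HasDerivAt (fun t => f t ψ) (fs s ψ) s) (hR : HasDerivAt R R' ψ₀)
    (hz : HasDerivAt (fun ψ => f (R ψ₀) ψ) z ψ₀) :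
    HasDerivAt (fun ψ => f (R ψ) ψ) (R' • fs (R ψ₀) ψ₀ + z) ψ₀ := by
  have h1 := (isLittleO_comp_sub hfs hf hR.continuousAt).trans_isBigO hR.isBigO_sub
  rw [hasDerivAt_iff_isLittleO] at hz hR ⊢
  have h2 : (fun ψ => (R ψ - R ψ₀ - (ψ - ψ₀) • R') • fs (R ψ₀) ψ₀) =o[𝓝 ψ₀] fun ψ => ψ - ψ₀ := by
    have := hR.smul_isBigO (Asymptotics.isBigO_refl (fun _ : ℝ => fs (R ψ₀) ψ₀) (𝓝 ψ₀))
    refine this.trans_isBigO ?_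
    have h := (Asymptotics.isBigO_refl (fun ψ : ℝ => ψ - ψ₀) (𝓝 ψ₀)).smul
      (Asymptotics.isBigO_const_const (fs (R ψ₀) ψ₀) (one_ne_zero (α := ℝ)) (𝓝 ψ₀))
    simpa using h
  refine ((h1.add h2).add hz).congr_left fun ψ => ?_
  simp only [sub_smul, smul_add, smul_eq_mul, mul_smul]
  abel

/-- Differentiability of an implicitly defined function. -/
theorem differentiableAt_of_implicit {f fs : ℝ → ℝ → ℝ} {R : ℝ → ℝ} {ψ₀ : ℝ}
    (hfs : ContinuousAt (fun q : ℝ × ℝ => fs q.1 q.2) (R ψ₀, ψ₀))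
    (hf : ∀ s ψ, HasDerivAt (fun t => f t ψ) (fs s ψ) s) (hR : ContinuousAt R ψ₀)
    (hz : DifferentiableAt ℝ (fun ψ => f (R ψ₀) ψ) ψ₀) (h0 : ∀ ψ, f (R ψ) ψ = 0)
    (hne : fs (R ψ₀) ψ₀ ≠ 0) : DifferentiableAt ℝ R ψ₀ := by
  set c := fs (R ψ₀) ψ₀ with hc
  have h1 := isLittleO_comp_sub hfs hf hR
  simp only [h0, zero_sub, ← hc, smul_eq_mul] at h1
  have hcr : (fun ψ => R ψ - R ψ₀) =O[𝓝 ψ₀] fun ψ => (R ψ - R ψ₀) * c := by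
    have := Asymptotics.isBigO_self_const_mul hne (fun ψ => R ψ - R ψ₀) (𝓝 ψ₀)
    simpa only [mul_comm] using this
  -- The error is known only relative to `R ψ - R ψ₀`. The equivalence bounds that increment by `f
  -- (R ψ₀) ψ`, which is `O(ψ - ψ₀)`.
  have heq : Asymptotics.IsEquivalent (𝓝 ψ₀) (fun ψ => -f (R ψ₀) ψ)
      (fun ψ => (R ψ - R ψ₀) * c) := h1.trans_isBigO hcr
  obtain ⟨z, hz⟩ : ∃ z, HasDerivAt (fun ψ => f (R ψ₀) ψ) z ψ₀ := ⟨_, hz.hasDerivAt⟩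
  have hO : (fun ψ => -f (R ψ₀) ψ) =O[𝓝 ψ₀] fun ψ => ψ - ψ₀ := by
    have := hz.isBigO_sub
    simp only [h0, sub_zero] at this
    exact this.neg_left
  have h2 : (fun ψ => -f (R ψ₀) ψ - (R ψ - R ψ₀) * c) =o[𝓝 ψ₀] fun ψ => ψ - ψ₀ :=
    h1.trans_isBigO (hcr.trans (heq.isBigO_symm.trans hO))
  have hd : HasDerivAt R (-z / c) ψ₀ := by
    rw [hasDerivAt_iff_isLittleO] at hz ⊢
    have := ((h2.add hz).const_mul_left (-c⁻¹))
    refine this.congr_left fun ψ => ?_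
    simp only [h0, smul_eq_mul]
    field_simp
    ring
  exact hd.differentiableAt

end Composition

/-! ### Continuity of the first zero. -/

section FirstZero

variable {k ξ ξs : ℝ → ℝ → ℝ} {R : ℝ → ℝ}

/-- The first positive zero of a continuous family of scalar Jacobi fields is continuous. -/
theorem continuous_firstZero (hJ : ∀ ψ, IsScalarJacobi (k ψ) fun s => ξ s ψ)
    (hξ : Continuous fun q : ℝ × ℝ => ξ q.1 q.2) (hξs : Continuous fun q : ℝ × ℝ => ξs q.1 q.2)
    (hd : ∀ s ψ, HasDerivAt (fun t => ξ t ψ) (ξs s ψ) s)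
    (hR : ∀ ψ, IsLeast {s | 0 < s ∧ ξ s ψ = 0} (R ψ)) (hneg : ∀ ψ, ξs (R ψ) ψ < 0) :
    Continuous R := by
  rw [continuous_iff_continuousAt]
  intro ψ₀
  refine tendsto_order.2 ⟨fun a ha => ?_, fun a ha => ?_⟩
  -- Positivity of `ξ` on `(0, a]` persists for nearby `ψ` by compactness of `[0, a]`. At `s = 0`,
  -- where `ξ` vanishes, positivity of `ξs` takes its place.
  · have hP : ∀ s ∈ Icc 0 a, ∀ᶠ q : ℝ × ℝ in 𝓝 (s, ψ₀), 0 < q.1 → 0 < ξ q.1 q.2 := by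
      intro s hs
      rcases hs.1.eq_or_lt with h0 | h0
      · have h1 : ∀ᶠ q : ℝ × ℝ in 𝓝 (s, ψ₀), 0 < ξs q.1 q.2 := by
          refine hξs.continuousAt.eventually_const_lt ?_
          have := (hd 0 ψ₀).deriv
          rw [(hJ ψ₀).deriv_zero] at this
          simp only [← h0, ← this, zero_lt_one]
        obtain ⟨δ, hδ, hb⟩ := Metric.eventually_nhds_iff_ball.1 h1
        filter_upwards [ball_mem_nhds _ hδ] with q hq hq0
        rw [← ball_prod_same] at hq
        obtain ⟨c, hc, he⟩ := exists_hasDerivAt_eq_slope (fun t => ξ t q.2) (fun t => ξs t q.2) hq0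
          (hJ q.2).continuous.continuousOn (fun t _ => hd t q.2)
        have hpos := hb (c, q.2) (by
          rw [← ball_prod_same]
          refine ⟨?_, hq.2⟩
          have := hq.1
          rw [← h0, mem_ball_zero_iff, Real.norm_of_nonneg hq0.le] at this
          rw [← h0, mem_ball_zero_iff, Real.norm_of_nonneg hc.1.le]
          exact hc.2.trans this)
        simp only at hpos
        rw [he, (hJ q.2).zero, sub_zero, sub_zero] at hpos
        exact (div_pos_iff_of_pos_right hq0).1 hpos
      · have : 0 < ξ s ψ₀ := (hJ ψ₀).pos_of_lt (hR ψ₀) h0 (hs.2.trans_lt ha)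
        have h := (hξ.continuousAt (x := (s, ψ₀))).eventually_const_lt this
        exact h.mono fun _ h _ => h
    have := isCompact_Icc.eventually_forall_of_forall_eventually (x₀ := ψ₀)
      (P := fun ψ s => 0 < s → 0 < ξ s ψ) (K := Icc 0 a) (fun s hs => by
        have := (continuous_swap.tendsto (ψ₀, s)).eventually (hP s hs)
        exact this)
    filter_upwards [this] with ψ hψ
    by_contra hle
    exact (hψ (R ψ) ⟨(hR ψ).1.1.le, not_lt.1 hle⟩ (hR ψ).1.1).ne' (hR ψ).1.2
  -- Past its first zero `ξ` turns negative; a negative value at `c` persists for nearby `ψ` and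
  -- puts their first zero before `c`.
  · obtain ⟨c, hc, hcneg⟩ : ∃ c ∈ Ioo (R ψ₀) a, ξ c ψ₀ < 0 := by
      have h := (hd (R ψ₀) ψ₀).hasDerivWithinAt (s := Ioi (R ψ₀))
      rw [hasDerivWithinAt_iff_tendsto_slope' (by simp)] at h
      obtain ⟨c, h1, h2⟩ :=
        ((h.eventually_lt_const (hneg ψ₀)).and (Ioo_mem_nhdsGT ha)).exists
      refine ⟨c, h2, ?_⟩
      rw [slope_def_field, (hR ψ₀).1.2, sub_zero] at h1
      by_contra hle
      exact (div_nonneg (not_lt.1 hle) (by linarith [h2.1])).not_gt h1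
    have : ∀ᶠ ψ in 𝓝 ψ₀, ξ c ψ < 0 := by
      have : Continuous fun ψ => ξ c ψ := hξ.comp (continuous_const.prodMk continuous_id)
      exact this.continuousAt.eventually_lt_const hcneg
    filter_upwards [this] with ψ hψ
    by_contra hle
    have hle' : c ≤ R ψ := hc.2.le.trans (not_lt.1 hle)
    have hc0 : 0 < c := (hR ψ₀).1.1.trans hc.1
    rcases hle'.eq_or_lt with h | h
    · rw [h, (hR ψ).1.2] at hψ
      exact lt_irrefl _ hψ
    · exact ((hJ ψ).pos_of_lt (hR ψ) hc0 h).not_gt hψ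

end FirstZero

/-! ### The field `ξ N` solves the linearised geodesic equation. -/

section JacobiField

variable {S : Set E3} {ν : E3 → E3} {G : E3 → E3}

/-- Computed as the derivative at `0` along the line `(x + t a, v + t b)`, where the product rules
of one variable suffice. -/
theorem fderiv_geodesicField_apply (hG : ContDiff ℝ ∞ G) (x v a b : E3) :
    fderiv ℝ (geodesicField G) (x, v) (a, b) =
      (b, (-(⟪fderiv ℝ (fderiv ℝ G) x a v, v⟫ + ⟪fderiv ℝ G x b, v⟫ + ⟪fderiv ℝ G x v, b⟫)) • G x -
        ⟪fderiv ℝ G x v, v⟫ • fderiv ℝ G x a) := by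
  have hline : ∀ y c : E3, HasDerivAt (fun t : ℝ => y + t • c) c 0 := fun y c => by
    simpa using ((hasDerivAt_id (0 : ℝ)).smul_const c).const_add y
  have hf := (((contDiff_geodesicField hG).differentiable (by simp)) (x, v)).hasFDerivAt
  have h1 : HasDerivAt (fun t : ℝ => geodesicField G (x + t • a, v + t • b))
      (fderiv ℝ (geodesicField G) (x, v) (a, b)) 0 := by
    have hc := (hline x a).prodMk (hline v b)
    have hf' : HasFDerivAt (geodesicField G) (fderiv ℝ (geodesicField G) (x, v))
        (x + (0 : ℝ) • a, v + (0 : ℝ) • b) := by simpa using hf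
    exact hf'.comp_hasDerivAt (0 : ℝ) hc
  have hGd : HasDerivAt (fun t : ℝ => G (x + t • a)) (fderiv ℝ G x a) 0 := by
    have h : HasFDerivAt G (fderiv ℝ G x) (x + (0 : ℝ) • a) := by
      simpa using ((hG.differentiable (by simp)) x).hasFDerivAt
    exact h.comp_hasDerivAt (0 : ℝ) (hline x a)
  have hDd : HasDerivAt (fun t : ℝ => fderiv ℝ G (x + t • a)) (fderiv ℝ (fderiv ℝ G) x a) 0 := by
    have h : HasFDerivAt (fderiv ℝ G) (fderiv ℝ (fderiv ℝ G) x) (x + (0 : ℝ) • a) := by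
      simpa using (((hG.fderiv_right (m := ∞) (by simp)).differentiable (by simp)) x).hasFDerivAt
    exact h.comp_hasDerivAt (0 : ℝ) (hline x a)
  have h2 := (hline v b).prodMk
    ((((hDd.clm_apply (hline v b)).inner ℝ (hline v b)).neg).smul hGd)
  rw [h1.unique h2]
  simp only [zero_smul, add_zero, inner_add_left, Pi.neg_apply]
  congr 1
  module

variable {γ : ℝ → E3}

/-- The unit normal `ν × γ'` of a unit speed geodesic satisfies `N' = -II(γ', N) ν`. -/
theorem IsGeodesic.hasDerivAt_cross (h : IsGeodesic S ν γ)
    (hν : IsUnitNormalField S ν) (hG : ContDiff ℝ ∞ G) (hGν : EqOn G ν S)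
    (h1 : ∀ t, ‖deriv γ t‖ = 1) (t : ℝ) :
    HasDerivAt (fun s => cross (ν (γ s)) (deriv γ s))
      ((-⟪fderiv ℝ G (γ t) (deriv γ t), cross (ν (γ t)) (deriv γ t)⟫) • ν (γ t)) t := by
  have hGd : ∀ t, HasDerivAt (fun s => ν (γ s)) (fderiv ℝ G (γ t) (deriv γ t)) t := fun t => by
    have := ((hG.differentiable (by simp)) (γ t)).hasFDerivAt.comp_hasDerivAt t (h.hasDerivAt t)
    exact this.congr_of_eventuallyEq (Eventually.of_forall fun s => (hGν (h.mem s)).symm)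
  have hν1 := fun s => hν.norm_eq_one _ (h.mem s)
  have h0 := h.inner_eq_zero hν
  set N : ℝ → E3 := fun s => cross (ν (γ s)) (deriv γ s) with hN
  have hd : DifferentiableAt ℝ N t :=
    ((contDiff_cross (n := 1)).differentiable (by simp) (ν (γ t), deriv γ t)).comp t
      (f := fun s => (ν (γ s), deriv γ s))
      ((hGd t).differentiableAt.prodMk (h.hasDerivAt_deriv t).differentiableAt)
  have hD := hd.hasDerivAt
  set D := deriv N t
  -- The components of `N'` in the frame `(ν, T, N)` come from differentiating the relations `⟪ν, N⟫
  -- = 0`, `⟪T, N⟫ = 0` and `⟪N, N⟫ = 1`.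
  have e1 : ⟪ν (γ t), D⟫ = -⟪fderiv ℝ G (γ t) (deriv γ t), N t⟫ := by
    have a := (hGd t).inner ℝ hD
    have b : HasDerivAt (fun s => ⟪ν (γ s), N s⟫) 0 t :=
      (hasDerivAt_const t (0 : ℝ)).congr_of_eventuallyEq
        (Eventually.of_forall fun s => inner_self_cross _ _)
    linarith [a.unique b]
  have e2 : ⟪deriv γ t, D⟫ = 0 := by
    have a := (h.hasDerivAt_deriv t).inner ℝ hD
    have b : HasDerivAt (fun s => ⟪deriv γ s, N s⟫) 0 t :=
      (hasDerivAt_const t (0 : ℝ)).congr_of_eventuallyEq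
        (Eventually.of_forall fun s => inner_cross_self _ _)
    have c := a.unique b
    rw [inner_smul_left, inner_self_cross, mul_zero, add_zero] at c
    exact c
  have e3 : ⟪N t, D⟫ = 0 := by
    have a := hD.inner ℝ hD
    have b : HasDerivAt (fun s => ⟪N s, N s⟫) 0 t :=
      (hasDerivAt_const t (1 : ℝ)).congr_of_eventuallyEq (Eventually.of_forall fun s => by
        simp only [hN]
        rw [real_inner_self_eq_norm_sq, norm_cross_eq_one (hν1 s) (h1 s) (h0 s), one_pow])
    have c := a.unique b
    have c' := real_inner_comm D (N t)
    linarith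
  have := eq_sum_frame (hν1 t) (h1 t) (h0 t) D
  rw [e2, show ⟪cross (ν (γ t)) (deriv γ t), D⟫ = 0 from e3, e1] at this
  rw [this] at hD
  simpa using hD

/-- If `ξ` is a scalar Jacobi field along a unit speed geodesic with unit normal `N`, then `ξ N`
solves the linearised geodesic equation. -/
theorem IsGeodesic.hasDerivAt_jacobiField (h : IsGeodesic S ν γ) (hS : IsSmoothSurface S)
    (hν : IsUnitNormalField S ν) (hG : ContDiff ℝ ∞ G) (hGν : EqOn G ν S)
    (h1 : ∀ t, ‖deriv γ t‖ = 1) {y : ℝ → ℝ}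
    (hy : IsScalarJacobi (fun s => gaussCurvature S ν (γ s)) y) (t : ℝ) :
    HasDerivAt (fun s => (y s • cross (ν (γ s)) (deriv γ s),
        deriv y s • cross (ν (γ s)) (deriv γ s) -
          (y s * ⟪fderiv ℝ G (γ s) (cross (ν (γ s)) (deriv γ s)), deriv γ s⟫) • ν (γ s)))
      (fderiv ℝ (geodesicField G) (γ t, deriv γ t) (y t • cross (ν (γ t)) (deriv γ t),
        deriv y t • cross (ν (γ t)) (deriv γ t) -
          (y t * ⟪fderiv ℝ G (γ t) (cross (ν (γ t)) (deriv γ t)), deriv γ t⟫) • ν (γ t))) t := by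
  have hGd : HasDerivAt (fun s => ν (γ s)) (fderiv ℝ G (γ t) (deriv γ t)) t := by
    have := ((hG.differentiable (by simp)) (γ t)).hasFDerivAt.comp_hasDerivAt t (h.hasDerivAt t)
    exact this.congr_of_eventuallyEq (Eventually.of_forall fun s => (hGν (h.mem s)).symm)
  have hDG : ContDiff ℝ ∞ (fderiv ℝ G) := hG.fderiv_right (by simp)
  have hDd : HasDerivAt (fun s => fderiv ℝ G (γ s)) (fderiv ℝ (fderiv ℝ G) (γ t) (deriv γ t)) t :=
    ((hDG.differentiable (by simp)) (γ t)).hasFDerivAt.comp_hasDerivAt t (h.hasDerivAt t)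
  have hq := h.mem t
  have hν1 := hν.norm_eq_one _ hq
  have h0 := h.inner_eq_zero hν t
  have hN := h.hasDerivAt_cross hν hG hGν h1 t
  have hT := h.hasDerivAt_deriv t
  have hd := (hDd.clm_apply hN).inner ℝ hT
  have hK := gaussCurvature_eq_shapeDet hS hν hG hGν hq (h1 t) h0
  have hy1 := hy.hasDerivAt t
  have hy2 := hy.hasDerivAt_deriv t
  have hAsol := (hy1.smul hN).prodMk ((hy2.smul hN).sub ((hy1.mul hd).smul hGd))
  refine hAsol.congr_deriv ?_
  -- The derivative of `II(N, T)` along the geodesic produces `D²G(T, N)`, the linearised field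
  -- `D²G(N, T)`; symmetry of second derivatives matches them.
  have hsymm2 : fderiv ℝ (fderiv ℝ G) (γ t) (cross (ν (γ t)) (deriv γ t)) (deriv γ t) =
      fderiv ℝ (fderiv ℝ G) (γ t) (deriv γ t) (cross (ν (γ t)) (deriv γ t)) :=
    ((hG.contDiffAt).isSymmSndFDerivAt (by
      rw [minSmoothness_of_isRCLikeNormedField]
      exact WithTop.coe_le_coe.2 (le_top (a := (2 : ℕ∞))))) _ _
  rw [fderiv_geodesicField_apply hG]
  simp only [shapeDet, hGν hq, Pi.mul_apply] at hK ⊢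
  rw [hK]
  have hnν : ⟪ν (γ t), cross (ν (γ t)) (deriv γ t)⟫ = 0 := inner_self_cross _ _
  have hnT : ⟪deriv γ t, cross (ν (γ t)) (deriv γ t)⟫ = 0 := inner_cross_self _ _
  have hfT := eq_sum_frame hν1 (h1 t) h0 (fderiv ℝ G (γ t) (deriv γ t))
  have hfN := eq_sum_frame hν1 (h1 t) h0
    (fderiv ℝ G (γ t) (cross (ν (γ t)) (deriv γ t)))
  have hsymm := inner_fderiv_comm hS hν hG hGν hq h0 hnν
  have hTν := inner_fderiv_normal hS hν hG hGν hq h0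
  have hNν := inner_fderiv_normal hS hν hG hGν hq hnν
  clear hAsol hd hN hK hy1 hy2 hDd hGd hT
  -- What remains is algebra in an orthonormal frame: expand `A v` and `A n`, use symmetry of `A`,
  -- and recognise its determinant in the curvature term.
  generalize cross (ν (γ t)) (deriv γ t) = n at *
  generalize fderiv ℝ (fderiv ℝ G) (γ t) = B at *
  generalize deriv γ t = v at *
  generalize ν (γ t) = m at *
  generalize fderiv ℝ G (γ t) = A at *
  generalize deriv y t = y' at *
  generalize y t = y at *
  have hAv : A v = ⟪A v, v⟫ • v + ⟪A n, v⟫ • n := by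
    rwa [real_inner_comm, hTν, zero_smul, zero_add, real_inner_comm, real_inner_comm _ n,
      hsymm] at hfT
  have hAn : A n = ⟪A n, v⟫ • v + ⟪A n, n⟫ • n := by
    rwa [real_inner_comm, hNν, zero_smul, zero_add, real_inner_comm, real_inner_comm _ n] at hfN
  have hBs : B (y • n) v = y • B v n := by rw [map_smul, smul_apply, hsymm2]
  rw [hBs]
  simp only [map_smul, map_sub, inner_add_left, inner_smul_left, inner_smul_right, inner_sub_left,
    inner_sub_right, hsymm, hNν, hTν, mul_zero, zero_add, sub_zero, conj_trivial]
  generalize ⟪A v, v⟫ = a at *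
  generalize ⟪A n, v⟫ = b at *
  generalize ⟪A n, n⟫ = d at *
  rw [hAv, hAn]
  refine Prod.ext ?_ ?_
  · dsimp only; module
  · dsimp only; module

end JacobiField

/-! ### The initial directions. -/

section Direction

variable {ν : E3 → E3} {p e : E3}

theorem inner_normal_direction (hpe : ⟪ν p, e⟫ = 0) (ψ : ℝ) : ⟪ν p, direction ν p e ψ⟫ = 0 := by
  rw [direction, inner_add_right, inner_smul_right, inner_smul_right, hpe, inner_self_cross]
  simp

theorem norm_direction (hp : ‖ν p‖ = 1) (he : ‖e‖ = 1) (hpe : ⟪ν p, e⟫ = 0) (ψ : ℝ) :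
    ‖direction ν p e ψ‖ = 1 := by
  have hc := norm_cross_eq_one hp he hpe
  have h0 : ⟪e, cross (ν p) e⟫ = 0 := inner_cross_self _ _
  have : ‖direction ν p e ψ‖ ^ 2 = 1 := by
    rw [direction, norm_add_sq_real, norm_smul, norm_smul, inner_smul_left, inner_smul_right, h0,
      he, hc]
    simp
  nlinarith [norm_nonneg (direction ν p e ψ)]

/-- Rotating the direction moves it by its quarter turn, which is `N` at `s = 0`. This is the
initial velocity component of the variation field. -/
theorem hasDerivAt_direction (hp : ‖ν p‖ = 1) (hpe : ⟪ν p, e⟫ = 0) (ψ : ℝ) :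
    HasDerivAt (direction ν p e) (cross (ν p) (direction ν p e ψ)) ψ := by
  have h := ((Real.hasDerivAt_cos ψ).smul_const e).add
    ((Real.hasDerivAt_sin ψ).smul_const (cross (ν p) e))
  refine h.congr_deriv ?_
  rw [direction, cross_add_right, cross_smul_right, cross_smul_right, cross_cross_eq, hpe,
    real_inner_self_eq_norm_sq, hp]
  module

end Direction

/-! ### The family of radial geodesics and its Jacobi fields. -/

section Family

variable {S : Set E3} {ν : E3 → E3} {G : E3 → E3}

theorem IsSmoothStrictlyConvexSurface.isCompact (hS : IsSmoothStrictlyConvexSurface S ν) :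
    IsCompact S := by
  obtain ⟨C, -, hC, -, rfl⟩ := hS.exists_body
  exact hC.of_isClosed_subset isClosed_frontier hC.isClosed.frontier_subset

/-- On the compact unit tangent bundle the curvature equals the continuous function `shapeDet G`, so
it attains a positive minimum, used for Sturm comparison, and is bounded, used for Gronwall. -/
theorem exists_bounds_gaussCurvature (hS : IsSmoothStrictlyConvexSurface S ν)
    (hG : ContDiff ℝ ∞ G) (hGν : EqOn G ν S) :
    ∃ c C : ℝ, 0 < c ∧ ∀ z ∈ unitTangents S ν,
      c ^ 2 ≤ gaussCurvature S ν z.1 ∧ |gaussCurvature S ν z.1| ≤ C := by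
  have hK := isCompact_unitTangents hS.isCompact hG hGν
  have hc := (contDiff_shapeDet hG).continuous
  have heq : ∀ z ∈ unitTangents S ν, gaussCurvature S ν z.1 = shapeDet G z := fun z hz =>
    gaussCurvature_eq_shapeDet hS.smooth hS.normal hG hGν hz.1 hz.2.1 hz.2.2
  rcases (unitTangents S ν).eq_empty_or_nonempty with he | hne
  · exact ⟨1, 1, one_pos, by simp [he]⟩
  obtain ⟨z, hz, hmin⟩ := hK.exists_isMinOn hne hc.continuousOn
  obtain ⟨C, hC⟩ := hK.exists_bound_of_continuousOn hc.continuousOn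
  have hpos : 0 < shapeDet G z := by
    rw [← heq z hz]
    exact hS.curvature_pos _ hz.1
  refine ⟨√(shapeDet G z), C, Real.sqrt_pos.2 hpos, fun w hw => ?_⟩
  rw [heq w hw, Real.sq_sqrt hpos.le]
  exact ⟨hmin hw, hC w hw⟩

/-- The geodesic equation coupled with the scalar Jacobi equation. -/
def jacobiSystem (G : E3 → E3) (z : (E3 × E3) × (ℝ × ℝ)) : (E3 × E3) × (ℝ × ℝ) :=
  (geodesicField G z.1, (z.2.2, -shapeDet G z.1 * z.2.1))

theorem contDiff_jacobiSystem (hG : ContDiff ℝ ∞ G) : ContDiff ℝ ∞ (jacobiSystem G) := by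
  have h1 := (contDiff_geodesicField hG).comp (contDiff_fst (𝕜 := ℝ) (E := E3 × E3) (F := ℝ × ℝ))
  have h2 := (contDiff_shapeDet hG).comp (contDiff_fst (𝕜 := ℝ) (E := E3 × E3) (F := ℝ × ℝ))
  exact h1.prodMk ((contDiff_snd.comp contDiff_snd).prodMk
    (h2.neg.mul (contDiff_fst.comp contDiff_snd)))

variable {p e : E3} {X : ℝ → ℝ → E3} {ξ : ℝ → ℝ → ℝ}

/-- The radial geodesics and the scalar Jacobi fields along them. -/
structure IsRadialFamily (S : Set E3) (ν : E3 → E3) (p e : E3) (X : ℝ → ℝ → E3)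
    (ξ : ℝ → ℝ → ℝ) : Prop where
  isGeodesic : ∀ ψ, IsGeodesic S ν fun s => X s ψ
  zero : ∀ ψ, X 0 ψ = p
  deriv_zero : ∀ ψ, deriv (fun s => X s ψ) 0 = direction ν p e ψ
  norm_deriv : ∀ s ψ, ‖deriv (fun s => X s ψ) s‖ = 1
  isScalarJacobi : ∀ ψ, IsScalarJacobi (fun s => gaussCurvature S ν (X s ψ)) fun s => ξ s ψ

theorem IsRadialFamily.mem_unitTangents (hX : IsRadialFamily S ν p e X ξ)
    (hν : IsUnitNormalField S ν) (s ψ : ℝ) :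
    (X s ψ, deriv (fun s => X s ψ) s) ∈ unitTangents S ν :=
  ⟨(hX.isGeodesic ψ).mem s, hX.norm_deriv s ψ, (hX.isGeodesic ψ).inner_eq_zero hν s⟩

/-- The stated derivative solves the linearised equation and has the right initial value `(0, N)`.
Its second component is the derivative of `T` in `ψ`, which later determines the geodesic curvature.
-/
theorem IsRadialFamily.hasDerivAt_param (hX : IsRadialFamily S ν p e X ξ)
    (hS : IsSmoothStrictlyConvexSurface S ν)
    (hG : ContDiff ℝ ∞ G) (hGν : EqOn G ν S) (hp : p ∈ S) (hpe : ⟪ν p, e⟫ = 0) (s ψ : ℝ) :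
    HasDerivAt (fun φ => (X s φ, deriv (fun s => X s φ) s))
      (ξ s ψ • cross (ν (X s ψ)) (deriv (fun s => X s ψ) s),
        deriv (fun s => ξ s ψ) s • cross (ν (X s ψ)) (deriv (fun s => X s ψ) s) -
          (ξ s ψ * ⟪fderiv ℝ G (X s ψ) (cross (ν (X s ψ)) (deriv (fun s => X s ψ) s)),
            deriv (fun s => X s ψ) s⟫) • ν (X s ψ)) ψ := by
  have hK := isCompact_unitTangents hS.isCompact hG hGν
  obtain ⟨r, hr0, hr⟩ := hK.isBounded.exists_pos_norm_le
  refine hasDerivAt_param_of_bounded (f := geodesicField G)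
    (u := fun s ψ => (X s ψ, deriv (fun s => X s ψ) s)) (ψ₀ := ψ)
    (w := fun s => (ξ s ψ • cross (ν (X s ψ)) (deriv (fun s => X s ψ) s),
        deriv (fun s => ξ s ψ) s • cross (ν (X s ψ)) (deriv (fun s => X s ψ) s) -
          (ξ s ψ * ⟪fderiv ℝ G (X s ψ) (cross (ν (X s ψ)) (deriv (fun s => X s ψ) s)),
            deriv (fun s => X s ψ) s⟫) • ν (X s ψ)))
    ((contDiff_geodesicField hG).of_le (by simp))
    (fun s ψ => (hX.isGeodesic ψ).hasDerivAt_geodesicField hS.normal hG hGν s)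
    (fun M => ⟨r, fun s _ ψ => hr _ (hX.mem_unitTangents hS.normal s ψ)⟩)
    (fun s => (hX.isGeodesic ψ).hasDerivAt_jacobiField hS.smooth hS.normal hG hGν
      (fun t => hX.norm_deriv t ψ) (hX.isScalarJacobi ψ) s) ?_ s
  simp only [hX.zero, hX.deriv_zero, (hX.isScalarJacobi ψ).zero, (hX.isScalarJacobi ψ).deriv_zero]
  refine ((hasDerivAt_const ψ p).prodMk
    (hasDerivAt_direction (hS.normal.norm_eq_one p hp) hpe ψ)).congr_deriv ?_
  simp

theorem IsRadialFamily.hasDerivAt_jacobiSystem (hX : IsRadialFamily S ν p e X ξ)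
    (hS : IsSmoothStrictlyConvexSurface S ν)
    (hG : ContDiff ℝ ∞ G) (hGν : EqOn G ν S) (s ψ : ℝ) :
    HasDerivAt (fun s => ((X s ψ, deriv (fun s => X s ψ) s), (ξ s ψ, deriv (fun s => ξ s ψ) s)))
      (jacobiSystem G ((X s ψ, deriv (fun s => X s ψ) s), (ξ s ψ, deriv (fun s => ξ s ψ) s))) s := by
  refine ((hX.isGeodesic ψ).hasDerivAt_geodesicField hS.normal hG hGν s).prodMk
    (((hX.isScalarJacobi ψ).hasDerivAt s).prodMk ?_)
  have h := hX.mem_unitTangents hS.normal s ψ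
  rw [← gaussCurvature_eq_shapeDet hS.smooth hS.normal hG hGν h.1 h.2.1 h.2.2]
  exact (hX.isScalarJacobi ψ).hasDerivAt_deriv s

theorem IsRadialFamily.exists_bound (hX : IsRadialFamily S ν p e X ξ)
    (hS : IsSmoothStrictlyConvexSurface S ν)
    (hG : ContDiff ℝ ∞ G) (hGν : EqOn G ν S) (M : ℝ) : ∃ r, ∀ s ∈ Icc (-M) M, ∀ ψ,
      ‖((X s ψ, deriv (fun s => X s ψ) s), (ξ s ψ, deriv (fun s => ξ s ψ) s))‖ ≤ r := by
  obtain ⟨r, hr0, hr⟩ := (isCompact_unitTangents hS.isCompact hG hGν).isBounded.exists_pos_norm_le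
  obtain ⟨c, C, -, hC⟩ := exists_bounds_gaussCurvature hS hG hGν
  exact ⟨max r (Real.exp ((1 + C) * (M + 1))), fun s hs ψ =>
    max_le_max (hr _ (hX.mem_unitTangents hS.normal s ψ))
      ((hX.isScalarJacobi ψ).norm_le
        (fun t => (hC _ (hX.mem_unitTangents hS.normal t ψ)).2) M s hs)⟩

theorem IsRadialFamily.continuous_uncurry (hX : IsRadialFamily S ν p e X ξ)
    (hS : IsSmoothStrictlyConvexSurface S ν)
    (hG : ContDiff ℝ ∞ G) (hGν : EqOn G ν S) (hp : p ∈ S) (hpe : ⟪ν p, e⟫ = 0) :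
    Continuous fun q : ℝ × ℝ => ((X q.1 q.2, deriv (fun s => X s q.2) q.1),
      (ξ q.1 q.2, deriv (fun s => ξ s q.2) q.1)) := by
  refine continuous_uncurry_of_bounded (f := jacobiSystem G)
    (u := fun s ψ => ((X s ψ, deriv (fun s => X s ψ) s), (ξ s ψ, deriv (fun s => ξ s ψ) s)))
    ((contDiff_jacobiSystem hG).of_le (by simp)) (hX.hasDerivAt_jacobiSystem hS hG hGν)
    (hX.exists_bound hS hG hGν) ?_
  have hd : Continuous (direction ν p e) := continuous_iff_continuousAt.2 fun ψ =>
    (hasDerivAt_direction (hS.normal.norm_eq_one p hp) hpe ψ).continuousAt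
  simp only [hX.zero, hX.deriv_zero, (hX.isScalarJacobi _).zero, (hX.isScalarJacobi _).deriv_zero]
  fun_prop

/-- Coupling `ξ` to the geodesic gives a smooth autonomous system, so parameter dependence applies
to `ξ` as well. No formula for the derivative is needed; any solution of the linearised system with
the right initial value serves. -/
theorem IsRadialFamily.differentiable_xi (hX : IsRadialFamily S ν p e X ξ)
    (hS : IsSmoothStrictlyConvexSurface S ν)
    (hG : ContDiff ℝ ∞ G) (hGν : EqOn G ν S) (hp : p ∈ S) (hpe : ⟪ν p, e⟫ = 0) (s : ℝ) :
    Differentiable ℝ fun ψ => ξ s ψ := by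
  intro ψ
  have hf : ContDiff ℝ ∞ (jacobiSystem G) := contDiff_jacobiSystem hG
  have huc := (hX.continuous_uncurry hS hG hGν hp hpe).comp
    (continuous_id.prodMk (continuous_const (y := ψ)))
  obtain ⟨w, hw0, hw⟩ := exists_global_solution_linear
    ((hf.continuous_fderiv (by simp)).comp huc)
    (((0, cross (ν p) (direction ν p e ψ)), (0, 0)) : (E3 × E3) × (ℝ × ℝ))
  have := hasDerivAt_param_of_bounded (f := jacobiSystem G)
    (u := fun s ψ => ((X s ψ, deriv (fun s => X s ψ) s), (ξ s ψ, deriv (fun s => ξ s ψ) s)))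
    (ψ₀ := ψ) (w := w) (hf.of_le (by simp)) (hX.hasDerivAt_jacobiSystem hS hG hGν)
    (hX.exists_bound hS hG hGν) hw (by
      simp only [hX.zero, hX.deriv_zero, (hX.isScalarJacobi _).zero,
        (hX.isScalarJacobi _).deriv_zero, hw0]
      exact ((hasDerivAt_const ψ p).prodMk
        (hasDerivAt_direction (hS.normal.norm_eq_one p hp) hpe ψ)).prodMk
        (hasDerivAt_const ψ ((0 : ℝ), (1 : ℝ)))) s
  exact this.differentiableAt.snd.fst

theorem isRadialFamily_polarExp (hS : IsSmoothStrictlyConvexSurface S ν) (hp : p ∈ S)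
    (he : ‖e‖ = 1) (hpe : ⟪ν p, e⟫ = 0) :
    IsRadialFamily S ν p e (polarExp S ν p e) (xi S ν p e) := by
  obtain ⟨G, hG, hGν⟩ := exists_contDiff_extension hS.smooth hS.normal hS.isCompact.isClosed
  have hp1 := hS.normal.norm_eq_one p hp
  have hgeo : ∀ ψ, IsGeodesic S ν (fun s => polarExp S ν p e s ψ) ∧ polarExp S ν p e 0 ψ = p ∧
      deriv (fun s => polarExp S ν p e s ψ) 0 = direction ν p e ψ := fun ψ =>
    Classical.epsilon_spec (exists_geodesic hS.smooth hS.normal hS.isCompact hp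
      (norm_direction hp1 he hpe ψ) (inner_normal_direction hpe ψ))
  have hnorm : ∀ s ψ, ‖deriv (fun s => polarExp S ν p e s ψ) s‖ = 1 := fun s ψ => by
    rw [(hgeo ψ).1.norm_deriv_eq hS.normal, (hgeo ψ).2.2, norm_direction hp1 he hpe]
  refine ⟨fun ψ => (hgeo ψ).1, fun ψ => (hgeo ψ).2.1, fun ψ => (hgeo ψ).2.2, hnorm, fun ψ => ?_⟩
  refine Classical.epsilon_spec (exists_isScalarJacobi ?_)
  have : (fun s => gaussCurvature S ν (polarExp S ν p e s ψ)) = fun s => shapeDet G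
      (polarExp S ν p e s ψ, deriv (fun s => polarExp S ν p e s ψ) s) := funext fun s =>
    gaussCurvature_eq_shapeDet hS.smooth hS.normal hG hGν ((hgeo ψ).1.mem s) (hnorm s ψ)
      ((hgeo ψ).1.inner_eq_zero hS.normal s)
  rw [this]
  refine (contDiff_shapeDet hG).continuous.comp (continuous_iff_continuousAt.2 fun s => ?_)
  exact ((hgeo ψ).1.hasDerivAt_geodesicField hS.normal hG hGν s).continuousAt

end Family

/-! ### Integration up to the cusps. -/

section ArcIntegral

/-- End points have measure zero, so the values of `f` at cusps do not matter, and integrability is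
inherited from the continuous `g`. -/
theorem intervalIntegrable_and_integral_eq_of_eqOn_Ioo {f g : ℝ → ℝ} (hg : Continuous g)
    {a b : ℝ} (hab : a < b) (h : EqOn f g (Ioo a b)) :
    IntervalIntegrable f MeasureTheory.volume a b ∧ ∫ x in a..b, f x = ∫ x in a..b, g x := by
  have hae : ∀ᵐ x ∂MeasureTheory.volume, x ∈ uIoc a b → g x = f x := by
    filter_upwards [MeasureTheory.Measure.ae_ne MeasureTheory.volume b] with x hx hxm
    rw [uIoc_of_le hab.le] at hxm
    exact (h ⟨hxm.1, lt_of_le_of_ne hxm.2 hx⟩).symm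
  refine ⟨(hg.intervalIntegrable a b).congr_ae ?_, (intervalIntegral.integral_congr_ae hae).symm⟩
  exact (MeasureTheory.ae_restrict_iff' measurableSet_uIoc).2 hae

end ArcIntegral

end ConjLocus

end

/-! ### The conjugate locus. -/

theorem mainTheorem7
    (S : Set ConjLocus.E3) (ν : ConjLocus.E3 → ConjLocus.E3)
    (hS : ConjLocus.IsSmoothStrictlyConvexSurface S ν)
    (p e : ConjLocus.E3) (hp : p ∈ S) (he : ‖e‖ = 1) (hpe : ⟪ν p, e⟫ = 0)
    (X : ℝ → ℝ → ConjLocus.E3) (hX : X = ConjLocus.polarExp S ν p e)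
    (T : ℝ → ℝ → ConjLocus.E3) (hT : T = ConjLocus.radialTangent S ν p e)
    (N : ℝ → ℝ → ConjLocus.E3) (hN : N = ConjLocus.radialNormal S ν p e)
    (ξ : ℝ → ℝ → ℝ) (hξ : ξ = ConjLocus.xi S ν p e)
    (ξs : ℝ → ℝ → ℝ) (hξs : ξs = ConjLocus.xiDeriv S ν p e)
    (R : ℝ → ℝ) (hR : R = ConjLocus.distFun S ν p e)
    (β : ℝ → ConjLocus.E3) (hβ : β = ConjLocus.conjLocus S ν p e)
    (τ : ℝ → ConjLocus.E3) (hτ : τ = ConjLocus.conjTangent S ν p e)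
    (kg : ℝ → ℝ) (hkg : kg = ConjLocus.geodesicCurvature ν β τ) :
    -- the objects are what their names say
    (∀ ψ, ConjLocus.IsGeodesic S ν (fun s => X s ψ) ∧ X 0 ψ = p ∧
      T 0 ψ = ConjLocus.direction ν p e ψ ∧
      ConjLocus.IsScalarJacobi (fun s => ConjLocus.gaussCurvature S ν (X s ψ))
        (fun s => ξ s ψ) ∧
      IsLeast {s : ℝ | 0 < s ∧ ξ s ψ = 0} (R ψ)) ∧
    (∀ s ψ, ‖T s ψ‖ = 1 ∧ HasDerivAt (fun φ => X s φ) (ξ s ψ • N s ψ) ψ) ∧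
    Differentiable ℝ R ∧
    (∀ ψ, HasDerivAt β (deriv R ψ • τ ψ) ψ) ∧
    -- the sign of the derivative of the Jacobi field at the first conjugate point
    (∀ ψ, ξs (R ψ) ψ < 0) ∧
    -- the geodesic curvature of the conjugate locus at its regular points
    (∀ ψ, deriv R ψ ≠ 0 →
      DifferentiableAt ℝ τ ψ ∧ kg ψ = ξs (R ψ) ψ / deriv R ψ ∧ kg ψ ≠ 0) ∧
    -- the total curvature of an arc, which may begin or end at a cusp
    (∀ a b : ℝ, a < b → (∀ ψ ∈ Set.Ioo a b, deriv R ψ ≠ 0) →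
      IntervalIntegrable (fun ψ => kg ψ * ConjLocus.signedSpeed β τ ψ) MeasureTheory.volume a b ∧
      IntervalIntegrable (fun ψ => ξs (R ψ) ψ) MeasureTheory.volume a b ∧
      ∫ ψ in a..b, kg ψ * ConjLocus.signedSpeed β τ ψ = ∫ ψ in a..b, ξs (R ψ) ψ) := by
  obtain ⟨G, hG, hGν⟩ := ConjLocus.exists_contDiff_extension hS.smooth hS.normal
    hS.isCompact.isClosed
  have hF : ConjLocus.IsRadialFamily S ν p e X ξ := by
    rw [hX, hξ]; exact ConjLocus.isRadialFamily_polarExp hS hp he hpe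
  have hTX : T = fun s ψ => deriv (fun s => X s ψ) s := by rw [hT, hX]; rfl
  have hξξ : ξs = fun s ψ => deriv (fun s => ξ s ψ) s := by rw [hξs, hξ]; rfl
  have hNT : ∀ s ψ, N s ψ = ConjLocus.cross (ν (X s ψ)) (T s ψ) := by
    intro s ψ; rw [hN, hX, hT]; rfl
  have hβX : β = fun ψ => X (R ψ) ψ := by rw [hβ, hX, hR]; rfl
  have hτT : τ = fun ψ => T (R ψ) ψ := by rw [hτ, hT, hR]; rfl
  have hcont := hF.continuous_uncurry hS hG hGν hp hpe
  have hpar := fun s ψ => hF.hasDerivAt_param hS hG hGν hp hpe s ψ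
  have hmem := fun s ψ => hF.mem_unitTangents hS.normal s ψ
  have hgeo := fun ψ => hF.isGeodesic ψ
  have hgeoODE := fun s ψ => (hF.isGeodesic ψ).hasDerivAt_geodesicField hS.normal hG hGν s
  have hJ := fun ψ => hF.isScalarJacobi ψ
  have hT0 := hF.deriv_zero
  have hξdiff := hF.differentiable_xi hS hG hGν hp hpe
  have hξd : ∀ s ψ, HasDerivAt (fun t => ξ t ψ) (ξs s ψ) s := by
    intro s ψ; rw [hξξ]; exact (hJ ψ).hasDerivAt s
  obtain ⟨c, C, hc, hbounds⟩ := ConjLocus.exists_bounds_gaussCurvature hS hG hGν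
  have hleast : ∀ ψ, IsLeast {s : ℝ | 0 < s ∧ ξ s ψ = 0} (R ψ) := by
    intro ψ
    have := (hJ ψ).isLeast_sInf ((hJ ψ).exists_zero hc fun s => (hbounds _ (hmem s ψ)).1)
    rw [hR, ConjLocus.distFun, ← hξ]
    exact this
  have hneg : ∀ ψ, ξs (R ψ) ψ < 0 := by
    intro ψ
    rw [hξξ]
    exact (hJ ψ).deriv_neg (fun s => (hbounds _ (hmem s ψ)).2) (hleast ψ)
  have hξ0 : ∀ ψ, ξ (R ψ) ψ = 0 := fun ψ => (hleast ψ).1.2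
  have hcξs : Continuous fun q : ℝ × ℝ => ξs q.1 q.2 := by
    rw [hξξ]; exact hcont.snd.snd
  have hcT : Continuous fun q : ℝ × ℝ => T q.1 q.2 := by
    rw [hTX]; exact hcont.fst.snd
  have hRc : Continuous R :=
    ConjLocus.continuous_firstZero hJ hcont.snd.fst hcξs hξd hleast hneg
  have hRd : Differentiable ℝ R := fun ψ =>
    ConjLocus.differentiableAt_of_implicit hcξs.continuousAt hξd hRc.continuousAt
      (hξdiff (R ψ) ψ) hξ0 (hneg ψ).ne
  have hXs : ∀ s ψ, HasDerivAt (fun t => X t ψ) (T s ψ) s := by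
    intro s ψ; rw [hTX]; exact (hgeo ψ).hasDerivAt s
  have hXψ : ∀ s ψ, HasDerivAt (fun φ => X s φ) (ξ s ψ • N s ψ) ψ := by
    intro s ψ
    rw [hNT, hTX]
    exact (hpar s ψ).fst
  have hβd : ∀ ψ, HasDerivAt β (deriv R ψ • τ ψ) ψ := by
    intro ψ
    have := ConjLocus.hasDerivAt_comp_param hcT.continuousAt hXs (hRd ψ).hasDerivAt
      (hXψ (R ψ) ψ)
    -- The conjugate point condition `ξ = 0` kills the variation in `ψ`, so `β` moves along the
    -- radial tangent only.
    rw [hξ0, zero_smul, add_zero] at this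
    rw [hβX, hτT]
    exact this
  have hT1 : ∀ s ψ, ‖T s ψ‖ = 1 := fun s ψ => by rw [hTX]; exact hF.norm_deriv s ψ
  have hνT : ∀ s ψ, ⟪ν (X s ψ), T s ψ⟫ = 0 := fun s ψ => by rw [hTX]; exact (hmem s ψ).2.2
  have hτd : ∀ ψ, ∃ α : ℝ, HasDerivAt τ (α • ν (β ψ) + ξs (R ψ) ψ • N (R ψ) ψ) ψ := by
    intro ψ
    have hTs : ∀ s ψ, HasDerivAt (fun t => T t ψ)
        (ConjLocus.geodesicField G (X s ψ, T s ψ)).2 s := by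
      intro s ψ; rw [hTX]; exact (hgeoODE s ψ).snd
    have hcont2 : Continuous fun q : ℝ × ℝ =>
        (ConjLocus.geodesicField G (X q.1 q.2, T q.1 q.2)).2 :=
      continuous_snd.comp ((ConjLocus.contDiff_geodesicField hG).continuous.comp
        (hcont.fst.fst.prodMk hcT))
    have hTψ : HasDerivAt (fun φ => T (R ψ) φ) (ξs (R ψ) ψ • N (R ψ) ψ) ψ := by
      have := hpar (R ψ) ψ
      -- Again `ξ = 0`: the second fundamental form term disappears and only `ξ_s N` is left.
      rw [hξ0, zero_mul, zero_smul ℝ (ν (X (R ψ) ψ)), sub_zero] at this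
      rw [hNT, hTX, hξξ]
      exact this.snd
    have := ConjLocus.hasDerivAt_comp_param (f := T) (fs := fun s ψ =>
      (ConjLocus.geodesicField G (X s ψ, T s ψ)).2) hcont2.continuousAt hTs (hRd ψ).hasDerivAt hTψ
    refine ⟨deriv R ψ * -⟪fderiv ℝ G (X (R ψ) ψ) (T (R ψ) ψ), T (R ψ) ψ⟫, ?_⟩
    rw [hβX, hτT]
    refine this.congr_deriv ?_
    simp only [ConjLocus.geodesicField, hGν ((hgeo ψ).mem (R ψ)), smul_smul]
  have hspeed : ∀ ψ, ConjLocus.signedSpeed β τ ψ = deriv R ψ := by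
    intro ψ
    rw [ConjLocus.signedSpeed, (hβd ψ).deriv, inner_smul_left, real_inner_self_eq_norm_sq, hτT,
      hT1]
    simp
  -- This holds also where `R' = 0`, both sides then being `0` by the convention for inverses. The
  -- normal coefficient `α` is irrelevant, since the covariant derivative removes it.
  have hkg' : ∀ ψ, kg ψ = ξs (R ψ) ψ / deriv R ψ := by
    intro ψ
    obtain ⟨α, hα⟩ := hτd ψ
    have hmemβ : β ψ ∈ S := by rw [hβX]; exact (hgeo ψ).mem _
    have hν1 := hS.normal.norm_eq_one _ hmemβ
    have hNβ : N (R ψ) ψ = ConjLocus.cross (ν (β ψ)) (τ ψ) := by rw [hNT, hβX, hτT]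
    have hN0 : ⟪ν (β ψ), N (R ψ) ψ⟫ = 0 := by
      rw [hNβ]; exact ConjLocus.inner_self_cross _ _
    have hN1 : ‖N (R ψ) ψ‖ = 1 := by
      rw [hNT]
      exact ConjLocus.norm_cross_eq_one (hS.normal.norm_eq_one _ ((hgeo ψ).mem _)) (hT1 _ _)
        (hνT _ _)
    have hcov : ConjLocus.covDeriv ν β τ ψ = ξs (R ψ) ψ • N (R ψ) ψ := by
      rw [ConjLocus.covDeriv, hα.deriv, inner_add_left, inner_smul_left, inner_smul_left,
        real_inner_self_eq_norm_sq, hν1, real_inner_comm, hN0]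
      simp
    rw [hkg, ConjLocus.geodesicCurvature, hspeed, hcov, ← hNβ, inner_smul_left, inner_smul_left,
      real_inner_self_eq_norm_sq, hN1]
    simp [div_eq_inv_mul]
  refine ⟨fun ψ => ⟨hgeo ψ, hF.zero ψ, by rw [hTX]; exact hT0 ψ, hJ ψ, hleast ψ⟩,
    fun s ψ => ⟨hT1 s ψ, hXψ s ψ⟩, hRd, hβd, hneg, fun ψ hψ => ?_, fun a b hab hne => ?_⟩
  · obtain ⟨α, hα⟩ := hτd ψ
    exact ⟨hα.differentiableAt, hkg' ψ, by rw [hkg']; exact div_ne_zero (hneg ψ).ne hψ⟩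
  -- The factor `R'` cancels the denominator of `k_g` inside the arc, leaving this function, which
  -- is continuous up to and across the cusps.
  · have hcψ : Continuous fun ψ => ξs (R ψ) ψ := hcξs.comp (hRc.prodMk continuous_id)
    have h := ConjLocus.intervalIntegrable_and_integral_eq_of_eqOn_Ioo
      (f := fun ψ => kg ψ * ConjLocus.signedSpeed β τ ψ) hcψ hab fun ψ hψ => by
        simp only [hkg', hspeed]
        exact div_mul_cancel₀ _ (hne ψ hψ)
    exact ⟨h.1, hcψ.intervalIntegrable a b, h.2⟩
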